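/- **Setting.** Let $\dot x=h(x)+Bu$, $x\in X$, $u\in U$, be a control system with $h:\mathbb R^N\to\mathbb R^N$ multi-affine (a polynomial of degree at most one in each variable), $B\in\mathbb R^{N\times m}$, $X\subset\mathbb R^N$ a full-dimensional closed rectangle and $U\subseteq\mathbb R^m$ polyhedral. Let $\Pi$ be a finite set of atomic propositions; each $\pi\in\Pi$ holds on a set $[\pi]\subseteq X$ that is a finite union of given rectangles. Let $R(q)$, $q\in Q$ ($Q$ finite), be closed full-dimensional rectangles with pairwise disjoint interiors and union $X$, each contained in one of the given rectangles, and such that there is exactly one $\pi=:o(q)$ with $R(q)\subseteq[\pi]$. Let $\Phi$ be a syntactically co-safe LTL formula built by $\pi,\neg\pi,\vee,\wedge,\mathcal U,\mathcal F$, interpreted over infinite words over $\Pi$; a finite word *satisfies* $\Phi$ if all its infinite continuations do. Let $\mathcal A=(S,\Pi,\delta_{\mathcal A},S_0,F)$ be a deterministic finite automaton (with possibly partial $\delta_{\mathcal A}$) that accepts only finite words satisfying $\Phi$ and accepts a prefix of every infinite word satisfying $\Phi$. Fix $\varepsilon\ge 0$ and $T\in\mathbb R$. **Abstraction.** The inputs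 at $q$ are the non-empty sets $E$ of facets of $R(q)$, each of which is also a facet of another rectangle of the partition, for which there is a multi-affine feedback $k:R(q)\to U$ such that at every vertex $v$ one has $n_{G}^\top(h(v)+Bk(v))\le-\varepsilon$ for all facets $G\ni v$ of $R(q)$ with $G\notin E$ ($n_G$ being the outer normal of $G$), and $0\notin\mathrm{Conv}\{h(v)+Bk(v)\mid v \text{ a vertex}\}$. Choose any such feedback $k_{q,E}$ for each $q$ and each of its inputs $E$. Put $\delta(q,E)=\{q'\mid R(q),R(q')\text{ have a common facet in }E\}$ and $w(q,E)=\min_{G\in E}T^G$. If $n_G^\top(h(v)+Bk_{q,E}(v))>0$ at all vertices $v$ of $R(q)$, then $T^G=\ln\!\big(\tfrac{s}{\bar s}\big)\tfrac{\ell}{s-\bar s}$, read as $\ell/\bar s$ if $s=\bar s$, where $s$ and $\bar s$ are the minima of this speed over the vertices of $G$ and of the opposite facet, and $\ell$ is the distance between these two facets; otherwise $T^G=\infty$. **Strategy.** The product automaton has states $Q\times S$, initial states $Q\times S_0$, final states $Q\times F$, transitions $\delta_P((q,s),E)=\{(q',s')\mid q'\in\delta(q,E),\ s'=\delta_{\mathcal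 A}(s,o(q))\}$ and weights $w(q,E)$. Let $(J,\Omega)$ be any result of the following algorithm. Initially $J=0$ on final states, $J=\infty$ elsewhere, and $SC$ is the set of predecessors of final states. While $SC\ne\emptyset$: remove some $p$ from $SC$; if $\mu=\min_E\big(\max_{p'\in\delta_P(p,E)}J(p')+w(p,E)\big)<J(p)$, the minimum being over inputs with $\delta_P(p,E)\neq\emptyset$, let $\Omega(p)$ be a minimizing $E$, set $J(p)=\mu$ and add all predecessors of $p$ to $SC$. Let $V_0=\{(q,s)\mid s\in S_0,\ J(q,s)<T\}$, let $Q_0$ be the projection of $V_0$ to $Q$, and let $X_0=\bigcup_{q\in Q_0}R(q)$. The control automaton $\mathcal A^C$ has the states, initial states and final states of $\mathcal A$; at memory $s$ and state $q$ it outputs $\Omega(q,s)$ if $J(q,s)<T$, and updates the memory to $\delta_{\mathcal A}(s,o(q))$. **Closed loop.** A closed-loop trajectory starts at a point of $R(q_0)$ with $(q_0,s_0)\in V_0$ at time $t_0=0$. From time $t_i$ on, as long as $s_i\notin F$, the feedback $k_{q_i,E}$ is applied, where $E$ is the output of $\mathcal A^C$ at $(s_i,q_i)$, until the time $t_{i+1}\ge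 t_i$ at which the trajectory leaves $R(q_i)$ through a facet in $E$; then $q_{i+1}$ is the rectangle on the other side of this facet and $s_{i+1}=\delta_{\mathcal A}(s_i,o(q_i))$. The trajectory is complete, and ends, at time $t_n$ when $s_n\in F$; the word it produces is $o(q_0)\cdots o(q_{n-1})$, the sequence of observations of the rectangles passed through (a visit may be instantaneous). **Theorem.** Let $x_0\in X_0$. For every $(q_0,s_0)\in V_0$ with $x_0\in R(q_0)$ there is a complete closed-loop trajectory starting at $x_0$ with this initial pair. Every closed-loop trajectory starting at $x_0$ can be continued to a complete one, and none switches infinitely often. Every complete one is a trajectory of the control system (it stays in $X$ and its control takes values in $U$), produces a word that satisfies $\Phi$, and takes time less than $T$. -/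

import Mathlib

open Set
open scoped ENNReal Matrix

namespace MultiAffineControl

/-! ### Syntactically co-safe LTL over a set `P` of atomic propositions -/

/-- Formulas `π | ¬π | Φ ∨ Φ | Φ ∧ Φ | Φ U Φ | F Φ`. -/
inductive ScLTL (P : Type*) where
  | atom (p : P)
  | negAtom (p : P)
  | disj (φ ψ : ScLTL P)
  | conj (φ ψ : ScLTL P)
  | untl (φ ψ : ScLTL P)
  | evtl (φ : ScLTL P)

/-- The word `w` shifted by `i` positions. -/
def suffix {P : Type*} (w : ℕ → P) (i : ℕ) : ℕ → P := fun j => w (i + j)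

/-- Satisfaction of a formula by an infinite word. The letter of a position is the one atomic
proposition that holds there. -/
def ScLTL.Sat {P : Type*} : ScLTL P → (ℕ → P) → Prop
  | .atom p, w => w 0 = p
  | .negAtom p, w => w 0 ≠ p
  | .disj φ ψ, w => φ.Sat w ∨ ψ.Sat w
  | .conj φ ψ, w => φ.Sat w ∧ ψ.Sat w
  | .untl φ ψ, w => ∃ i, ψ.Sat (suffix w i) ∧ ∀ j < i, φ.Sat (suffix w j)
  | .evtl φ, w => ∃ i, φ.Sat (suffix w i)

/-- The finite word `u` is a prefix of the infinite word `w`. -/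
def IsPrefix {P : Type*} (u : List P) (w : ℕ → P) : Prop :=
  ∀ (i : ℕ) (hi : i < u.length), w i = u[i]

/-- A finite word satisfies a co-safe formula if all its infinite continuations do. -/
def ScLTL.SatFinite {P : Type*} (φ : ScLTL P) (u : List P) : Prop :=
  ∀ w : ℕ → P, IsPrefix u w → φ.Sat w

/-! ### Automata, weighted transition systems and their product -/

/-- A deterministic automaton with state set `S` and input alphabet `P`; the transition function
may be partial (`none` means undefined). -/
structure FSA (S P : Type*) where
  next : S → P → Option S
  start : Set S
  accept : Set S

/-- The automaton has an accepting run on the finite word `u`. -/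
def FSA.Accepts {S P : Type*} (A : FSA S P) (u : List P) : Prop :=
  ∃ r : ℕ → S, r 0 ∈ A.start ∧ r u.length ∈ A.accept ∧
    ∀ (i : ℕ) (hi : i < u.length), A.next (r i) u[i] = some (r (i + 1))

/-- The automaton accepts satisfying prefixes of `φ`, and at least one such prefix of every
infinite word that satisfies `φ`. -/
structure FSA.Recognizes {S P : Type*} (A : FSA S P) (φ : ScLTL P) : Prop where
  sound : ∀ u : List P, A.Accepts u → φ.SatFinite u
  complete : ∀ w : ℕ → P, φ.Sat w → ∃ u : List P, IsPrefix u w ∧ A.Accepts u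

/-- A weighted transition system with states `Q`, inputs `I` and observations `O`. The weight
`∞` is allowed. -/
structure WTS (Q I O : Type*) where
  succ : Q → I → Set Q
  obs : Q → O
  weight : Q → I → ℝ≥0∞
  weight_pos : ∀ q i, 0 < weight q i

/-- A nondeterministic automaton with weights on its state-input pairs. -/
structure WeightedAut (V I : Type*) where
  succ : V → I → Set V
  start : Set V
  accept : Set V
  weight : V → I → ℝ≥0∞

/-- The product of a weighted transition system with an automaton that reads its observations. -/
def product {Q I O S : Type*} (W : WTS Q I O) (A : FSA S O) : WeightedAut (Q × S) I where
  succ p σ := {p' | p'.1 ∈ W.succ p.1 σ ∧ A.next p.2 (W.obs p.1) = some p'.2}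
  start := {p | p.2 ∈ A.start}
  accept := {p | p.2 ∈ A.accept}
  weight p σ := W.weight p.1 σ

/-! ### The fixed-point algorithm -/

/-- The variables of the algorithm: cost `J`, feedback `Ω` (`none` where it has not been assigned)
and the set `SC` of states that remain to be examined. -/
structure AlgState (V I : Type*) where
  J : V → ℝ≥0∞
  Ω : V → Option I
  SC : Set V

namespace WeightedAut

variable {V I : Type*}

open Classical in
/-- `max_{v' ∈ succ v σ} J v' + weight v σ`, for an input `σ` that is available at `v`. An input
without successors is not available, which is expressed by the value `∞`. -/
noncomputable def candidate (P : WeightedAut V I) (J : V → ℝ≥0∞) (v : V) (σ : I) : ℝ≥0∞ :=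
  if (P.succ v σ).Nonempty then (⨆ v' ∈ P.succ v σ, J v') + P.weight v σ else ⊤

open Classical in
/-- Initialization: cost `0` at the final states and `∞` elsewhere; `SC` consists of the
predecessors of the final states. -/
noncomputable def algInit (P : WeightedAut V I) : AlgState V I where
  J v := if v ∈ P.accept then 0 else ⊤
  Ω _ := none
  SC := {v | ∃ σ, ∃ f ∈ P.accept, f ∈ P.succ v σ}

open Classical in
/-- One execution of the body of the while loop, for some state `v ∈ SC` and, if the cost of `v`
is improved, some minimizing input `σ`. -/
inductive AlgStep (P : WeightedAut V I) : AlgState V I → AlgState V I → Prop where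
  | skip (a : AlgState V I) (v : V) (hv : v ∈ a.SC)
      (h : ¬ (⨅ σ, P.candidate a.J v σ) < a.J v) :
      AlgStep P a ⟨a.J, a.Ω, a.SC \ {v}⟩
  | update (a : AlgState V I) (v : V) (hv : v ∈ a.SC)
      (h : (⨅ σ, P.candidate a.J v σ) < a.J v)
      (σ : I) (hσ : ∀ σ', P.candidate a.J v σ ≤ P.candidate a.J v σ') :
      AlgStep P a
        ⟨Function.update a.J v (P.candidate a.J v σ),
         Function.update a.Ω v (some σ),
         (a.SC \ {v}) ∪ {v' | ∃ σ', v ∈ P.succ v' σ'}⟩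

/-- `(J, Ω)` is a result of the algorithm: some run of it ends (with `SC = ∅`) in `(J, Ω)`. -/
def IsAlgResult (P : WeightedAut V I) (J : V → ℝ≥0∞) (Ω : V → Option I) : Prop :=
  Relation.ReflTransGen P.AlgStep P.algInit ⟨J, Ω, ∅⟩

/-- The initial states with cost less than `T`. -/
def winningStart (P : WeightedAut V I) (J : V → ℝ≥0∞) (T : ℝ) : Set V :=
  {v | v ∈ P.start ∧ J v < ENNReal.ofReal T}

end WeightedAut

/-! ### Feedback control automata -/

/-- A feedback control automaton: it reads the current state in `Q` of a transition system,
outputs the input in `I` to be applied there, and updates its memory state in `S`. -/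
structure ControlAut (S Q I : Type*) where
  start : Set S
  accept : Set S
  next : S → Q → Option S
  out : S → Q → Option I

open Classical in
/-- The feedback control automaton `A^C` obtained from a feedback `Ω` on the product. -/
noncomputable def controlAut {Q I O S : Type*} (W : WTS Q I O) (A : FSA S O)
    (J : Q × S → ℝ≥0∞) (Ω : Q × S → Option I) (T : ℝ) : ControlAut S Q I where
  start := A.start
  accept := A.accept
  next s q := A.next s (W.obs q)
  out s q := if J (q, s) < ENNReal.ofReal T then Ω (q, s) else none

/-! ### Rectangles, facets, multi-affine functions -/

/-- A full-dimensional rectangle `R_N(a, b)` in `ℝ^N`. -/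
structure Rect (N : ℕ) where
  lo : Fin N → ℝ
  hi : Fin N → ℝ
  lo_lt_hi : ∀ i, lo i < hi i

/-- Facets are indexed by their outer normals: `(i, true)` stands for the facet with normal `e_i`
and `(i, false)` for the one with normal `-e_i`. -/
abbrev Facet (N : ℕ) := Fin N × Bool

/-- The index of the opposite facet. -/
def Facet.opp {N : ℕ} (F : Facet N) : Facet N := (F.1, !F.2)

/-- The outer normal of a facet. -/
def Facet.normal {N : ℕ} (F : Facet N) : Fin N → ℝ :=
  Pi.single F.1 (if F.2 then 1 else -1)

namespace Rect

variable {N : ℕ}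

/-- The rectangle as a (closed) set. -/
def toSet (r : Rect N) : Set (Fin N → ℝ) := {x | ∀ i, r.lo i ≤ x i ∧ x i ≤ r.hi i}

/-- The vertex with coordinate `hi i` where `ξ i = true` and `lo i` elsewhere. -/
def vertex (r : Rect N) (ξ : Fin N → Bool) : Fin N → ℝ :=
  fun i => if ξ i then r.hi i else r.lo i

/-- The facet `F` as a set. -/
def facet (r : Rect N) (F : Facet N) : Set (Fin N → ℝ) :=
  {x | x ∈ r.toSet ∧ x F.1 = if F.2 then r.hi F.1 else r.lo F.1}

/-- The open half-space on the outer side of the facet `F`. -/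
def beyond (r : Rect N) (F : Facet N) : Set (Fin N → ℝ) :=
  {x | if F.2 then r.hi F.1 < x F.1 else x F.1 < r.lo F.1}

/-- The minimal speed, in the direction of the outer normal of `F`, of the vector field `f` at the
vertices of the facet `G` (a minimum over a finite non-empty set). -/
noncomputable def minSpeed (r : Rect N) (f : (Fin N → ℝ) → (Fin N → ℝ)) (F G : Facet N) : ℝ :=
  ⨅ ξ : {ξ : Fin N → Bool // ξ G.1 = G.2}, F.normal ⬝ᵥ f (r.vertex ξ.1)

open Classical in
/-- The time bound `T^F`: with `s = s_F` and `s' = s_{F̄}` the minimal speeds on `F` and on the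
opposite facet, `ln (s / s') (b_i - a_i) / (s - s')` (and its limit `(b_i - a_i) / s'` if `s = s'`),
if the speed towards `F` is positive at all vertices, and `∞` otherwise. -/
noncomputable def facetTimeBound (r : Rect N) (f : (Fin N → ℝ) → (Fin N → ℝ)) (F : Facet N) :
    ℝ≥0∞ :=
  if ∀ ξ, 0 < F.normal ⬝ᵥ f (r.vertex ξ) then
    ENNReal.ofReal
      (if r.minSpeed f F F = r.minSpeed f F F.opp then
        (r.hi F.1 - r.lo F.1) / r.minSpeed f F F.opp
      else
        Real.log (r.minSpeed f F F / r.minSpeed f F F.opp) *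
          ((r.hi F.1 - r.lo F.1) / (r.minSpeed f F F - r.minSpeed f F F.opp)))
  else ⊤

/-- The time bound for a set of exit facets: the minimum of the bounds of its elements. -/
noncomputable def timeBound (r : Rect N) (f : (Fin N → ℝ) → (Fin N → ℝ))
    (E : Finset (Facet N)) : ℝ≥0∞ :=
  E.inf (r.facetTimeBound f)

theorem minSpeed_pos (r : Rect N) (f : (Fin N → ℝ) → (Fin N → ℝ)) (F G : Facet N)
    (h : ∀ ξ, 0 < F.normal ⬝ᵥ f (r.vertex ξ)) : 0 < r.minSpeed f F G := by
  have : Nonempty {ξ : Fin N → Bool // ξ G.1 = G.2} := ⟨⟨fun _ => G.2, rfl⟩⟩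
  obtain ⟨ξ, hξ⟩ := exists_eq_ciInf_of_finite
    (f := fun ξ : {ξ : Fin N → Bool // ξ G.1 = G.2} => F.normal ⬝ᵥ f (r.vertex ξ.1))
  unfold minSpeed
  rw [← hξ]
  exact h ξ.1

theorem timeBound_pos (r : Rect N) (f : (Fin N → ℝ) → (Fin N → ℝ)) (E : Finset (Facet N)) :
    0 < r.timeBound f E := by
  unfold timeBound
  rw [Finset.lt_inf_iff (by simp)]
  intro F _
  unfold facetTimeBound
  split_ifs with h h'
  · rw [ENNReal.ofReal_pos]
    exact div_pos (sub_pos.2 (r.lo_lt_hi _)) (r.minSpeed_pos f F F.opp h)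
  · rw [ENNReal.ofReal_pos]
    have h1 := r.minSpeed_pos f F F h
    have h2 := r.minSpeed_pos f F F.opp h
    have h3 : 0 < r.hi F.1 - r.lo F.1 := sub_pos.2 (r.lo_lt_hi _)
    rcases lt_or_gt_of_ne h' with hlt | hgt
    · exact mul_pos_of_neg_of_neg (Real.log_neg (div_pos h1 h2) ((div_lt_one h2).2 hlt))
        (div_neg_of_pos_of_neg h3 (sub_neg.2 hlt))
    · exact mul_pos (Real.log_pos ((one_lt_div h2).2 hgt)) (div_pos h3 (sub_pos.2 hgt))
  · simp

end Rect

/-- Multi-affine functions: polynomials of degree at most one in each variable, written as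
`∑_I (∏_{i ∈ I} x_i) c_I`, where `I` runs through the sets of variables. -/
def IsMultiAffine {N k : ℕ} (g : (Fin N → ℝ) → (Fin k → ℝ)) : Prop :=
  ∃ c : Finset (Fin N) → (Fin k → ℝ), ∀ x, g x = ∑ I, (∏ i ∈ I, x i) • c I

/-- Polyhedral sets: finite intersections of closed half-spaces. -/
def IsPolyhedral {m : ℕ} (U : Set (Fin m → ℝ)) : Prop :=
  ∃ (r : ℕ) (G : Matrix (Fin r) (Fin m) ℝ) (c : Fin r → ℝ), U = {u | ∀ i, (G *ᵥ u) i ≤ c i}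

/-! ### The control system and its partition -/

/-- The multi-affine control system `ẋ = h(x) + B u`, `x ∈ X`, `u ∈ U`. -/
structure ControlSystem (N m : ℕ) where
  X : Rect N
  h : (Fin N → ℝ) → (Fin N → ℝ)
  h_multiAffine : IsMultiAffine h
  B : Matrix (Fin N) (Fin m) ℝ
  U : Set (Fin m → ℝ)
  U_polyhedral : IsPolyhedral U

namespace ControlSystem

variable {N m : ℕ}

/-- The closed-loop vector field of a feedback `k`. -/
def closedLoop (sys : ControlSystem N m) (k : (Fin N → ℝ) → (Fin m → ℝ)) :
    (Fin N → ℝ) → (Fin N → ℝ) :=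
  fun x => sys.h x + sys.B *ᵥ k x

/-- `x` is a trajectory of the control system on `[0, τ]`, for some control with values in `U`;
at the instants where the control switches, the derivative is the one from the right. -/
def IsTrajectory (sys : ControlSystem N m) (x : ℝ → (Fin N → ℝ)) (τ : ℝ) : Prop :=
  ContinuousOn x (Icc 0 τ) ∧ (∀ t ∈ Icc 0 τ, x t ∈ sys.X.toSet) ∧
    ∃ u : ℝ → (Fin m → ℝ), ∀ t ∈ Ico 0 τ, u t ∈ sys.U ∧
      HasDerivWithinAt x (sys.h (x t) + sys.B *ᵥ u t) (Ici t) t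

/-- `k` solves the control problem for the rectangle `r` and the exit facets `E`, with robustness
parameter `ε`: it is a multi-affine feedback `r → U`; at every vertex the speed towards each facet
through that vertex outside `E` is at most `-ε`; and `0` is not in the convex hull of the values of
the closed-loop field at the vertices. -/
structure IsFacetSolution (sys : ControlSystem N m) (ε : ℝ) (r : Rect N) (E : Finset (Facet N))
    (k : (Fin N → ℝ) → (Fin m → ℝ)) : Prop where
  multiAffine : IsMultiAffine k
  mapsTo : MapsTo k r.toSet sys.U
  inward : ∀ (ξ : Fin N → Bool) (F : Facet N), ξ F.1 = F.2 → F ∉ E →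
    F.normal ⬝ᵥ sys.closedLoop k (r.vertex ξ) ≤ -ε
  zero_notMem : (0 : Fin N → ℝ) ∉
    convexHull ℝ (range fun ξ : Fin N → Bool => sys.closedLoop k (r.vertex ξ))

end ControlSystem

/-- Regions of interest: to each atomic proposition, finitely many rectangles inside `X`. -/
structure Regions {N : ℕ} (X : Rect N) (P : Type*) where
  num : P → ℕ
  rect : (p : P) → Fin (num p) → Rect N
  subset : ∀ p j, (rect p j).toSet ⊆ X.toSet

/-- The set `[π]` where an atomic proposition holds. -/
def Regions.region {N : ℕ} {X : Rect N} {P : Type*} (ρ : Regions X P) (p : P) :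
    Set (Fin N → ℝ) :=
  ⋃ j, (ρ.rect p j).toSet

/-- A proposition-preserving partition of `X` into rectangles, indexed by `Q`, which may overlap
only at their boundaries. Each of them lies in one of the given rectangles, and `obs q` is the
proposition that holds on the rectangle of `q`. -/
structure RectPartition {N : ℕ} {X : Rect N} {P : Type*} (ρ : Regions X P) (Q : Type*) where
  rect : Q → Rect N
  cover : ⋃ q, (rect q).toSet = X.toSet
  disjoint : ∀ q q', q ≠ q' → Disjoint (interior (rect q).toSet) (interior (rect q').toSet)
  obs : Q → P
  obs_subset : ∀ q, ∃ j, (rect q).toSet ⊆ (ρ.rect (obs q) j).toSet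
  obs_eq : ∀ q p, (rect q).toSet ⊆ ρ.region p → obs q = p

section Abstraction

variable {N m : ℕ} {P Q : Type*}

/-- `q'` lies on the other side of the facet `F` of `q`, which is a common facet of both. -/
def RectPartition.CommonFacet {X : Rect N} {ρ : Regions X P} (D : RectPartition ρ Q)
    (q q' : Q) (F : Facet N) : Prop :=
  (D.rect q).facet F = (D.rect q').facet F.opp

variable (sys : ControlSystem N m) {ρ : Regions sys.X P} (D : RectPartition ρ Q) (ε : ℝ)

/-- The input `E` is available at `q`: `E` is a non-empty set of facets of the rectangle of `q`,
each of them shared with another rectangle of the partition (so that the state is not driven out of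
`X`), and the corresponding control problem has a solution. -/
def Available (q : Q) (E : Finset (Facet N)) : Prop :=
  E.Nonempty ∧ (∀ F ∈ E, ∃ q', D.CommonFacet q q' F) ∧
    ∃ k, sys.IsFacetSolution ε (D.rect q) E k

/-- `K` assigns to each rectangle and each available set of exit facets a multi-affine feedback
that solves the corresponding control problem. -/
def IsFeedbackFamily (K : Q → Finset (Facet N) → (Fin N → ℝ) → (Fin m → ℝ)) : Prop :=
  ∀ q E, Available sys D ε q E → sys.IsFacetSolution ε (D.rect q) E (K q E)

/-- The weighted transition system defined by the partition and the feedbacks. -/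
noncomputable def abstraction (K : Q → Finset (Facet N) → (Fin N → ℝ) → (Fin m → ℝ)) :
    WTS Q (Finset (Facet N)) P where
  succ q E := {q' | Available sys D ε q E ∧ ∃ F ∈ E, D.CommonFacet q q' F}
  obs := D.obs
  weight q E := (D.rect q).timeBound (sys.closedLoop (K q E)) E
  weight_pos _ _ := Rect.timeBound_pos _ _ _

end Abstraction

/-! ### Closed-loop trajectories -/

/-- On `[t₀, t₁]`, `x` solves `ẋ = f(x)` and stays in the rectangle `r`. -/
def SolvesIn {N : ℕ} (f : (Fin N → ℝ) → (Fin N → ℝ)) (r : Rect N) (x : ℝ → (Fin N → ℝ))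
    (t₀ t₁ : ℝ) : Prop :=
  t₀ ≤ t₁ ∧ ∀ t ∈ Icc t₀ t₁, x t ∈ r.toSet ∧ HasDerivWithinAt x (f (x t)) (Icc t₀ t₁) t

/-- At the point `z`, the flow of `f` leaves `r` through the facet `F`: `z` belongs to `F`, and the
solution of `ẏ = f(y)` that starts at `z` is beyond `F` at arbitrarily small positive times. This
is the case when the speed of `f` towards `F` is positive at `z ∈ F`. -/
def LeavesThrough {N : ℕ} (f : (Fin N → ℝ) → (Fin N → ℝ)) (r : Rect N) (F : Facet N)
    (z : Fin N → ℝ) : Prop :=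
  z ∈ r.facet F ∧ ∃ (η : ℝ) (y : ℝ → (Fin N → ℝ)), 0 < η ∧ y 0 = z ∧
    (∀ t ∈ Icc 0 η, HasDerivWithinAt y (f (y t)) (Icc 0 η) t) ∧
    ∀ δ ∈ Ioc 0 η, ∃ t ∈ Ioo 0 δ, y t ∈ r.beyond F

/-- The data of a switched trajectory on `[0, τ]` with `n` switches: `t i` is the time of the
`i`-th switch (`t 0 = 0`), `q i` the rectangle visited from `t i` on and `s i` the memory of the
control automaton during that visit, for `i ≤ n`; the values for `i > n` are irrelevant. -/
structure SwitchedPath (N : ℕ) (Q S : Type*) where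
  n : ℕ
  q : ℕ → Q
  s : ℕ → S
  t : ℕ → ℝ
  x : ℝ → (Fin N → ℝ)
  τ : ℝ

section ClosedLoop

variable {N m : ℕ} {P Q S : Type*} (sys : ControlSystem N m) {ρ : Regions sys.X P}
  (D : RectPartition ρ Q) (K : Q → Finset (Facet N) → (Fin N → ℝ) → (Fin m → ℝ))
  (C : ControlAut S Q (Finset (Facet N))) (V₀ : Set (Q × S))

/-- The switched path is a trajectory of the system under the control strategy, starting from a
pair in `V₀`. While the rectangle is `q` and the memory is `s`, the feedback `K q E` is applied,
where `E` is the output of the control automaton, until the trajectory leaves the rectangle through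
a facet in `E`; then the rectangle on the other side of that facet becomes the current one and the
memory is updated. The process stops when the memory is a final state. -/
structure IsClosedLoop (e : SwitchedPath N Q S) : Prop where
  t_zero : e.t 0 = 0
  start : (e.q 0, e.s 0) ∈ V₀
  switch : ∀ i < e.n, e.s i ∉ C.accept ∧
    ∃ E, C.out (e.s i) (e.q i) = some E ∧
      SolvesIn (sys.closedLoop (K (e.q i) E)) (D.rect (e.q i)) e.x (e.t i) (e.t (i + 1)) ∧
      (∃ F ∈ E, LeavesThrough (sys.closedLoop (K (e.q i) E)) (D.rect (e.q i)) F
          (e.x (e.t (i + 1))) ∧ D.CommonFacet (e.q i) (e.q (i + 1)) F) ∧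
      C.next (e.s i) (e.q i) = some (e.s (i + 1))
  last_mem : e.x (e.t e.n) ∈ (D.rect (e.q e.n)).toSet
  last_le : e.t e.n ≤ e.τ
  last : e.t e.n < e.τ → e.s e.n ∉ C.accept ∧
    ∃ E, C.out (e.s e.n) (e.q e.n) = some E ∧
      SolvesIn (sys.closedLoop (K (e.q e.n) E)) (D.rect (e.q e.n)) e.x (e.t e.n) e.τ

end ClosedLoop

namespace SwitchedPath

variable {N : ℕ} {P Q S : Type*}

/-- The path has reached a final state of the control automaton (and ends there). -/
def IsComplete {I : Type*} (e : SwitchedPath N Q S) (C : ControlAut S Q I) : Prop :=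
  e.s e.n ∈ C.accept

/-- The word produced by the path: the observations of the rectangles it has passed through. -/
def word (e : SwitchedPath N Q S) (obs : Q → P) : List P :=
  List.ofFn fun i : Fin e.n => obs (e.q i)

/-- `e'` is a continuation of `e`. -/
structure Extends (e' e : SwitchedPath N Q S) : Prop where
  n_le : e.n ≤ e'.n
  τ_le : e.τ ≤ e'.τ
  q_eq : ∀ i ≤ e.n, e'.q i = e.q i
  s_eq : ∀ i ≤ e.n, e'.s i = e.s i
  t_eq : ∀ i ≤ e.n, e'.t i = e.t i
  x_eq : ∀ t ∈ Icc 0 e.τ, e'.x t = e.x t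
  le_t : ∀ i, e.n < i → i ≤ e'.n → e.τ ≤ e'.t i

end SwitchedPath

/-- The initial set `X₀`: the union of the rectangles of the states in the projection `Q₀` of the
set `V₀` of initial states of the product. -/
def initialSet {N : ℕ} {X : Rect N} {P Q S : Type*} {ρ : Regions X P} (D : RectPartition ρ Q)
    (V₀ : Set (Q × S)) : Set (Fin N → ℝ) :=
  ⋃ q ∈ Prod.fst '' V₀, (D.rect q).toSet

end MultiAffineControl

open MultiAffineControl

namespace MultiAffineControl

open Filter Topology
open scoped NNReal

/-! ### Multi-affine functions on rectangles -/

/-! The cost `J` is a Lyapunov function for the closed loop. At every non-final product state of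
finite cost, the algorithm leaves `J` at least as large as the weight of the chosen input plus the
cost of each of its successors (`IsAlgResult.costBound`). If the weight bounds the time spent in the
current rectangle, then elapsed time plus remaining cost never increases along a trajectory
(`IsClosedLoop.time_add_cost_le`), so it stays below `T`. Weights are positive, so the cost falls
strictly at each switch; as `Q × S` is finite, there are finitely many switches. The memory sequence
is itself a run of the automaton on the produced word, so reaching a final memory state means
acceptance, hence satisfaction of the formula.

What remains is analysis in a single rectangle. A multi-affine field at a point is a convex
combination of its values at the vertices, with the same coefficients for all fields
(`dotProduct_eq_sum_coeff`). Conditions at vertices therefore extend to facets and to the rectangle: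
the field does not point outwards on facets outside `E`, and the speed towards `F` is at least an
affine function of the distance to `F`. Integrating the reciprocal of that function yields the bound
`T^F` (`SolvesIn.ofReal_sub_le_facetTimeBound`).

A finite cost forces a finite time bound, so the solution must leave the rectangle. A Grönwall
estimate for the squared distance to the rectangle (`mem_toSet_of_notMem_beyond`) shows that it
cannot do so without going beyond a facet of `E`. Hence every incomplete trajectory has a next
switch (`exists_solvesIn_leavesThrough`, `IsClosedLoop.exists_extends_succ`). -/

theorem Facet.normal_dotProduct {N : ℕ} (F : Facet N) (v : Fin N → ℝ) :
    F.normal ⬝ᵥ v = if F.2 then v F.1 else -v F.1 := by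
  unfold Facet.normal
  rw [single_dotProduct]
  split_ifs <;> simp

theorem IsMultiAffine.closedLoop {N m : ℕ} (sys : ControlSystem N m)
    {k : (Fin N → ℝ) → (Fin m → ℝ)} (hk : IsMultiAffine k) :
    IsMultiAffine (sys.closedLoop k) := by
  obtain ⟨c, hc⟩ := sys.h_multiAffine
  obtain ⟨d, hd⟩ := hk
  refine ⟨fun I => c I + sys.B *ᵥ d I, fun x => ?_⟩
  simp only [ControlSystem.closedLoop, hc x, hd x, smul_add, Finset.sum_add_distrib]
  simp only [Matrix.mulVec_sum, Matrix.mulVec_smul]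

theorem IsMultiAffine.contDiff {N k : ℕ} {g : (Fin N → ℝ) → (Fin k → ℝ)} (hg : IsMultiAffine g) :
    ContDiff ℝ 1 g := by
  obtain ⟨c, hc⟩ := hg
  rw [funext hc]
  exact ContDiff.sum fun I _ => (contDiff_prod fun i _ => contDiff_apply ℝ ℝ i).smul contDiff_const

namespace Rect

variable {N : ℕ} (r : Rect N)

/-- The coefficient of the vertex with index `ξ` in the expression of the values of multi-affine
functions at `x` by their values at the vertices. -/
noncomputable def coeff (x : Fin N → ℝ) (ξ : Fin N → Bool) : ℝ :=
  ∏ i, (if ξ i then x i - r.lo i else r.hi i - x i) / (r.hi i - r.lo i)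

theorem coeff_nonneg {x : Fin N → ℝ} (hx : x ∈ r.toSet) (ξ : Fin N → Bool) :
    0 ≤ r.coeff x ξ := by
  refine Finset.prod_nonneg fun i _ => div_nonneg ?_ (sub_nonneg.2 (r.lo_lt_hi i).le)
  have := hx i
  split_ifs <;> linarith

/-- Both factors are products over the coordinates, so the sum over all vertices factors into one
sum over the two endpoints per coordinate. Each of these is linear interpolation of `x i` between
the endpoints, or of the constant `1` when `i ∉ I`. -/
theorem sum_coeff_mul_prod_vertex (x : Fin N → ℝ) (I : Finset (Fin N)) :
    ∑ ξ, r.coeff x ξ * ∏ i ∈ I, r.vertex ξ i = ∏ i ∈ I, x i := by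
  classical
  have key : ∀ i, ∑ b : Bool, (if b then x i - r.lo i else r.hi i - x i) / (r.hi i - r.lo i) *
      (if i ∈ I then (if b then r.hi i else r.lo i) else 1) = if i ∈ I then x i else 1 := by
    intro i
    have h : r.hi i - r.lo i ≠ 0 := (sub_pos.2 (r.lo_lt_hi i)).ne'
    by_cases hi : i ∈ I
    · simp only [Fintype.sum_bool, if_true, hi, Bool.false_eq_true, if_false]
      field_simp
      ring
    · simp only [Fintype.sum_bool, if_true, hi, Bool.false_eq_true, if_false]
      field_simp
      ring
  have h := Finset.prod_univ_sum (fun _ : Fin N => (Finset.univ : Finset Bool))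
    (fun i b => (if b then x i - r.lo i else r.hi i - x i) / (r.hi i - r.lo i) *
      (if i ∈ I then (if b then r.hi i else r.lo i) else 1))
  simp only [key, Fintype.piFinset_univ, Finset.prod_mul_distrib] at h
  simp only [Finset.prod_ite_mem, Finset.univ_inter] at h
  exact h.symm

theorem sum_coeff (x : Fin N → ℝ) : ∑ ξ, r.coeff x ξ = 1 := by
  simpa using r.sum_coeff_mul_prod_vertex x ∅

theorem sum_coeff_mul_vertex (x : Fin N → ℝ) (i : Fin N) :
    ∑ ξ, r.coeff x ξ * r.vertex ξ i = x i := by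
  simpa using r.sum_coeff_mul_prod_vertex x {i}

theorem dotProduct_eq_sum_coeff {k : ℕ} {g : (Fin N → ℝ) → (Fin k → ℝ)} (hg : IsMultiAffine g)
    (n : Fin k → ℝ) (x : Fin N → ℝ) :
    n ⬝ᵥ g x = ∑ ξ, r.coeff x ξ * (n ⬝ᵥ g (r.vertex ξ)) := by
  obtain ⟨c, hc⟩ := hg
  simp only [hc, dotProduct_sum, dotProduct_smul, smul_eq_mul, Finset.mul_sum]
  rw [Finset.sum_comm]
  refine Finset.sum_congr rfl fun I _ => ?_
  rw [← r.sum_coeff_mul_prod_vertex x I, Finset.sum_mul]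
  simp only [mul_assoc]

/-- The signed distance of `x` from the hyperplane of the facet `F`, positive beyond `F`. -/
noncomputable def excess (F : Facet N) (x : Fin N → ℝ) : ℝ :=
  if F.2 then x F.1 - r.hi F.1 else r.lo F.1 - x F.1

theorem mem_beyond {F : Facet N} {x : Fin N → ℝ} : x ∈ r.beyond F ↔ 0 < r.excess F x := by
  unfold beyond excess
  rw [mem_ofPred_eq]
  split_ifs <;> simp

theorem mem_toSet_iff_excess {x : Fin N → ℝ} : x ∈ r.toSet ↔ ∀ F, r.excess F x ≤ 0 := by
  constructor
  · intro h F
    have := h F.1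
    unfold excess
    split_ifs <;> linarith
  · intro h i
    have h1 := h (i, true)
    have h2 := h (i, false)
    simp only [excess, if_true, Bool.false_eq_true, if_false] at h1 h2
    constructor <;> linarith

theorem mem_facet {F : Facet N} {x : Fin N → ℝ} :
    x ∈ r.facet F ↔ x ∈ r.toSet ∧ r.excess F x = 0 := by
  unfold facet excess
  rw [mem_ofPred_eq]
  split_ifs
  · rw [sub_eq_zero]
  · rw [sub_eq_zero, eq_comm (a := x F.1)]

theorem continuous_excess (F : Facet N) : Continuous (r.excess F) := by
  unfold excess
  split_ifs <;> fun_prop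

theorem hasDerivWithinAt_excess {F : Facet N} {x : ℝ → Fin N → ℝ} {v : Fin N → ℝ} {s : Set ℝ}
    {t : ℝ} (hx : HasDerivWithinAt x v s t) :
    HasDerivWithinAt (fun t => r.excess F (x t)) (F.normal ⬝ᵥ v) s t := by
  have := hasDerivWithinAt_pi.1 hx F.1
  rw [Facet.normal_dotProduct]
  unfold excess
  split_ifs
  · exact this.sub_const _
  · exact this.const_sub _

theorem isClosed_toSet : IsClosed r.toSet := by
  have : r.toSet = ⋂ F, {x | r.excess F x ≤ 0} := by
    ext x
    simp [mem_toSet_iff_excess]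
  rw [this]
  exact isClosed_iInter fun F => isClosed_le (r.continuous_excess F) continuous_const

theorem excess_vertex_of_eq {F : Facet N} {ξ : Fin N → Bool} (h : ξ F.1 = F.2) :
    r.excess F (r.vertex ξ) = 0 := by
  unfold excess vertex
  rw [h]
  split_ifs <;> simp

theorem excess_vertex_of_ne {F : Facet N} {ξ : Fin N → Bool} (h : ξ F.1 ≠ F.2) :
    r.excess F (r.vertex ξ) = r.lo F.1 - r.hi F.1 := by
  unfold excess vertex
  cases h1 : ξ F.1 <;> cases h2 : F.2 <;> simp_all

theorem sum_coeff_mul_excess_vertex (x : Fin N → ℝ) (F : Facet N) :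
    ∑ ξ, r.coeff x ξ * r.excess F (r.vertex ξ) = r.excess F x := by
  unfold excess
  split_ifs
  · simp only [mul_sub, Finset.sum_sub_distrib, r.sum_coeff_mul_vertex, ← Finset.sum_mul,
      r.sum_coeff, one_mul]
  · simp only [mul_sub, Finset.sum_sub_distrib, r.sum_coeff_mul_vertex, ← Finset.sum_mul,
      r.sum_coeff, one_mul]

theorem coeff_eq_zero_of_mem_facet {F : Facet N} {x : Fin N → ℝ} (hx : x ∈ r.facet F)
    {ξ : Fin N → Bool} (h : ξ F.1 ≠ F.2) : r.coeff x ξ = 0 := by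
  refine Finset.prod_eq_zero (Finset.mem_univ F.1) ?_
  have := hx.2
  cases h1 : ξ F.1 <;> cases h2 : F.2 <;> simp_all

/-- The speed of a multi-affine field towards the facet `F` is non-positive on `F` if it is so at
the vertices of `F`. -/
theorem speed_nonpos_of_mem_facet {f : (Fin N → ℝ) → (Fin N → ℝ)} (hf : IsMultiAffine f)
    {F : Facet N} (h : ∀ ξ, ξ F.1 = F.2 → F.normal ⬝ᵥ f (r.vertex ξ) ≤ 0) {x : Fin N → ℝ}
    (hx : x ∈ r.facet F) : F.normal ⬝ᵥ f x ≤ 0 := by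
  rw [r.dotProduct_eq_sum_coeff hf]
  refine Finset.sum_nonpos fun ξ _ => ?_
  by_cases hξ : ξ F.1 = F.2
  · exact mul_nonpos_of_nonneg_of_nonpos (r.coeff_nonneg hx.1 ξ) (h ξ hξ)
  · rw [r.coeff_eq_zero_of_mem_facet hx hξ, zero_mul]

theorem minSpeed_le (f : (Fin N → ℝ) → (Fin N → ℝ)) (F G : Facet N) {ξ : Fin N → Bool}
    (h : ξ G.1 = G.2) : r.minSpeed f F G ≤ F.normal ⬝ᵥ f (r.vertex ξ) :=
  ciInf_le (Finite.bddBelow_range fun ξ : {ξ : Fin N → Bool // ξ G.1 = G.2} =>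
    F.normal ⬝ᵥ f (r.vertex ξ.1)) ⟨ξ, h⟩

/-- On the rectangle, the speed towards `F` is at least the linear interpolation of the minimal
speeds on `F` and on the opposite facet. -/
theorem interpolation_le_speed {f : (Fin N → ℝ) → (Fin N → ℝ)} (hf : IsMultiAffine f)
    (F : Facet N) {x : Fin N → ℝ} (hx : x ∈ r.toSet) :
    r.minSpeed f F F + (r.minSpeed f F F - r.minSpeed f F F.opp) / (r.hi F.1 - r.lo F.1) *
      r.excess F x ≤ F.normal ⬝ᵥ f x := by
  have hl : r.hi F.1 - r.lo F.1 ≠ 0 := (sub_pos.2 (r.lo_lt_hi _)).ne'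
  -- The left side is affine in `x`, so it is reproduced by the vertex coefficients and only the
  -- vertices need checking: the excess is `0` on `F` and minus the side length on the opposite
  -- facet, which gives exactly the two minimal speeds.
  have key : ∀ ξ, r.minSpeed f F F + (r.minSpeed f F F - r.minSpeed f F F.opp) /
      (r.hi F.1 - r.lo F.1) * r.excess F (r.vertex ξ) ≤ F.normal ⬝ᵥ f (r.vertex ξ) := by
    intro ξ
    by_cases hξ : ξ F.1 = F.2
    · rw [r.excess_vertex_of_eq hξ, mul_zero, add_zero]
      exact r.minSpeed_le f F F hξ
    · rw [r.excess_vertex_of_ne hξ]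
      have h : r.minSpeed f F F.opp ≤ F.normal ⬝ᵥ f (r.vertex ξ) :=
        r.minSpeed_le f F F.opp (by cases h1 : ξ F.1 <;> cases h2 : F.2 <;> simp_all [Facet.opp])
      refine le_trans (le_of_eq ?_) h
      field_simp
      ring
  calc _ = ∑ ξ, r.coeff x ξ * (r.minSpeed f F F + (r.minSpeed f F F - r.minSpeed f F F.opp) /
        (r.hi F.1 - r.lo F.1) * r.excess F (r.vertex ξ)) := by
        simp only [mul_add, Finset.sum_add_distrib, ← Finset.sum_mul, r.sum_coeff, one_mul,
          mul_left_comm (r.coeff x _), ← Finset.mul_sum, r.sum_coeff_mul_excess_vertex]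
    _ ≤ ∑ ξ, r.coeff x ξ * (F.normal ⬝ᵥ f (r.vertex ξ)) :=
        Finset.sum_le_sum fun ξ _ => mul_le_mul_of_nonneg_left (key ξ) (r.coeff_nonneg hx ξ)
    _ = _ := (r.dotProduct_eq_sum_coeff hf _ x).symm

theorem neg_le_excess {F : Facet N} {x : Fin N → ℝ} (hx : x ∈ r.toSet) :
    r.lo F.1 - r.hi F.1 ≤ r.excess F x := by
  have := hx F.1
  unfold excess
  split_ifs <;> linarith

end Rect

/-! ### Differential inequalities -/

/-- Squaring removes the kink of `max u 0`; this makes the squared distance to a rectangle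
differentiable along solutions. -/
theorem hasDerivAt_max_zero_sq (u : ℝ) :
    HasDerivAt (fun u : ℝ => max u 0 ^ 2) (2 * max u 0) u := by
  rcases lt_trichotomy u 0 with h | rfl | h
  · rw [max_eq_right h.le, mul_zero]
    refine (hasDerivAt_const u (0 : ℝ)).congr_of_eventuallyEq ?_
    filter_upwards [Iio_mem_nhds h] with v hv
    rw [max_eq_right (le_of_lt hv)]
    simp
  · rw [max_self, mul_zero, hasDerivAt_iff_tendsto_slope]
    have h : Tendsto (fun v : ℝ => max v 0) (𝓝[≠] 0) (𝓝 0) := by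
      have : Continuous fun v : ℝ => max v 0 := by fun_prop
      simpa using (this.tendsto 0).mono_left nhdsWithin_le_nhds
    refine h.congr' ?_
    filter_upwards [self_mem_nhdsWithin] with v hv
    rw [slope_def_field, max_self]
    rcases le_total v 0 with h | h
    · simp [max_eq_right h]
    · rw [max_eq_left h]
      have : v ≠ 0 := hv
      field_simp
      ring
  · rw [max_eq_left h.le]
    have : HasDerivAt (fun v : ℝ => v ^ 2) (2 * u) u := by simpa using hasDerivAt_pow 2 u
    refine this.congr_of_eventuallyEq ?_
    filter_upwards [Ioi_mem_nhds h] with v hv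
    rw [max_eq_left (le_of_lt hv)]

/-- A quantity `e` in `[-l, 0]` with growth rate at least `σ e > 0` needs at most the time
`∫ 1 / σ` from `-l` to `0`. -/
theorem sub_le_of_le_deriv {e e' Ψ σ : ℝ → ℝ} {t₀ t₁ l : ℝ} (h01 : t₀ ≤ t₁)
    (he : ∀ t ∈ Icc t₀ t₁, HasDerivWithinAt e (e' t) (Icc t₀ t₁) t)
    (hmem : ∀ t ∈ Icc t₀ t₁, e t ∈ Icc (-l) 0) (hσe : ∀ t ∈ Icc t₀ t₁, σ (e t) ≤ e' t)
    (hσ : ∀ u ∈ Icc (-l) 0, 0 < σ u) (hΨ : ∀ u ∈ Icc (-l) 0, HasDerivAt Ψ (σ u)⁻¹ u) :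
    t₁ - t₀ ≤ Ψ 0 - Ψ (-l) := by
  -- `Ψ` is an antiderivative of `1 / σ`, so `Ψ (e t) - t` has derivative `e' t / σ (e t) - 1 ≥ 0`.
  have hd : ∀ t ∈ Icc t₀ t₁,
      HasDerivWithinAt (fun t => Ψ (e t) - t) ((σ (e t))⁻¹ * e' t - 1) (Icc t₀ t₁) t := fun t ht =>
    ((hΨ _ (hmem t ht)).comp_hasDerivWithinAt t (he t ht)).sub (hasDerivWithinAt_id t _)
  have hm : MonotoneOn (fun t => Ψ (e t) - t) (Icc t₀ t₁) := by
    refine monotoneOn_of_hasDerivWithinAt_nonneg (convex_Icc _ _)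
      (fun t ht => (hd t ht).continuousWithinAt)
      (fun t ht => (hd t (interior_subset ht)).mono interior_subset) fun t ht => ?_
    have ht' := interior_subset ht
    have h1 := hσ _ (hmem t ht')
    rw [sub_nonneg, inv_mul_eq_div, one_le_div h1]
    exact hσe t ht'
  have hΨm : MonotoneOn Ψ (Icc (-l) 0) :=
    monotoneOn_of_hasDerivWithinAt_nonneg (convex_Icc _ _)
      (fun u hu => (hΨ u hu).continuousAt.continuousWithinAt)
      (fun u hu => (hΨ u (interior_subset hu)).hasDerivWithinAt)
      fun u hu => (inv_pos.2 (hσ u (interior_subset hu))).le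
  have m0 := hmem t₀ (left_mem_Icc.2 h01)
  have m1 := hmem t₁ (right_mem_Icc.2 h01)
  have hl : -l ≤ 0 := m0.1.trans m0.2
  have h1 := hm (left_mem_Icc.2 h01) (right_mem_Icc.2 h01) h01
  have h2 := hΨm m1 (right_mem_Icc.2 hl) m1.2
  have h3 := hΨm (left_mem_Icc.2 hl) m0 m0.1
  simp only at h1
  linarith

/-- A bounded Lipschitz field has solutions on all compact intervals. -/
theorem exists_solution {X : Type*} [NormedAddCommGroup X] [NormedSpace ℝ X] [CompleteSpace X]
    {g : X → X} {L M : ℝ≥0} (hg : LipschitzWith L g) (hM : ∀ x, ‖g x‖ ≤ M) (z : X) {b : ℝ}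
    (hb : 0 ≤ b) :
    ∃ y : ℝ → X, y 0 = z ∧ ∀ t ∈ Icc 0 b, HasDerivWithinAt y (g (y t)) (Icc 0 b) t := by
  -- With the global bound `M`, a solution moves at most `M * b` in time `b`; a ball of that radius
  -- puts no restriction on `b`.
  have hp : IsPicardLindelof (fun _ => g) (⟨0, left_mem_Icc.2 hb⟩ : Icc 0 b) z
      (M * ⟨b, hb⟩) 0 M L :=
    { lipschitzOnWith := fun _ _ => hg.lipschitzOnWith
      continuousOn := fun _ _ => continuousOn_const
      norm_le := fun _ _ x _ => hM x
      mul_max_le := by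
        simp only [sub_zero, sub_self, max_eq_left hb, NNReal.coe_zero]
        exact le_rfl }
  exact hp.exists_eq_forall_mem_Icc_hasDerivWithinAt₀

namespace Rect

variable {N : ℕ} (r : Rect N)

/-! ### The nearest-point map of a rectangle -/

/-- The point of the rectangle nearest to `x`. -/
noncomputable def clamp (x : Fin N → ℝ) : Fin N → ℝ := fun i => max (r.lo i) (min (r.hi i) (x i))

theorem clamp_mem (x : Fin N → ℝ) : r.clamp x ∈ r.toSet := fun i =>
  ⟨le_max_left _ _, max_le (r.lo_lt_hi i).le (min_le_left _ _)⟩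

theorem clamp_eq_self {x : Fin N → ℝ} (hx : x ∈ r.toSet) : r.clamp x = x := by
  funext i
  rw [clamp, min_eq_right (hx i).2, max_eq_right (hx i).1]

theorem lipschitzWith_clamp : LipschitzWith 1 r.clamp := by
  refine LipschitzWith.of_dist_le_mul fun x y => ?_
  rw [NNReal.coe_one, one_mul, dist_pi_le_iff dist_nonneg]
  intro i
  have h : LipschitzWith 1 fun u : ℝ => max (r.lo i) (min (r.hi i) u) :=
    (LipschitzWith.id.const_min _).const_max _
  simpa [clamp] using (h.dist_le_mul (x i) (y i)).trans
    (mul_le_mul_of_nonneg_left (dist_le_pi_dist x y i) (NNReal.coe_nonneg 1))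

/-- A point beyond `F` is compared with its nearest point, which lies on `F`, where the sign of the
normal speed is known. -/
theorem clamp_mem_facet {F : Facet N} {x : Fin N → ℝ} (h : 0 < r.excess F x) :
    r.clamp x ∈ r.facet F := by
  refine ⟨r.clamp_mem x, ?_⟩
  have hl := r.lo_lt_hi F.1
  unfold excess at h
  unfold clamp
  split_ifs with hF
  · rw [if_pos hF] at h
    rw [min_eq_left (by linarith), max_eq_right hl.le]
  · rw [if_neg hF] at h
    rw [min_eq_right (by linarith), max_eq_left (by linarith)]

/-- The squared Euclidean distance of `x` from the rectangle. -/
noncomputable def sqDist (x : Fin N → ℝ) : ℝ := ∑ F, max (r.excess F x) 0 ^ 2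

theorem max_excess_sq_le_sqDist (F : Facet N) (x : Fin N → ℝ) :
    max (r.excess F x) 0 ^ 2 ≤ r.sqDist x :=
  Finset.single_le_sum (f := fun F => max (r.excess F x) 0 ^ 2) (fun _ _ => sq_nonneg _)
    (Finset.mem_univ F)

theorem mem_toSet_iff_sqDist {x : Fin N → ℝ} : x ∈ r.toSet ↔ r.sqDist x ≤ 0 := by
  rw [mem_toSet_iff_excess]
  constructor
  · intro h
    refine Finset.sum_nonpos fun F _ => ?_
    rw [max_eq_right (h F)]
    simp
  · intro h F
    by_contra! hF
    have := r.max_excess_sq_le_sqDist F x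
    rw [max_eq_left hF.le] at this
    nlinarith

theorem dist_clamp_le (x : Fin N → ℝ) : dist x (r.clamp x) ≤ √(r.sqDist x) := by
  rw [dist_pi_le_iff (Real.sqrt_nonneg _)]
  intro i
  rw [Real.dist_eq]
  refine Real.abs_le_sqrt ?_
  have hl := r.lo_lt_hi i
  unfold clamp
  rcases le_total (r.hi i) (x i) with h | h
  · rw [min_eq_left h, max_eq_right hl.le]
    refine le_trans (le_of_eq ?_) (r.max_excess_sq_le_sqDist (i, true) x)
    simp only [excess, if_true]
    rw [max_eq_left (sub_nonneg.2 h)]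
  · rw [min_eq_right h]
    rcases le_total (r.lo i) (x i) with h' | h'
    · rw [max_eq_right h', sub_self]
      refine le_trans (le_of_eq (by simp)) (Finset.sum_nonneg fun F _ => sq_nonneg _)
    · rw [max_eq_left h']
      refine le_trans (le_of_eq ?_) (r.max_excess_sq_le_sqDist (i, false) x)
      simp only [excess, Bool.false_eq_true, if_false]
      rw [max_eq_left (sub_nonneg.2 h')]
      ring

theorem abs_normal_dotProduct_le (F : Facet N) (v : Fin N → ℝ) : |F.normal ⬝ᵥ v| ≤ ‖v‖ := by
  rw [Facet.normal_dotProduct]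
  have := norm_le_pi_norm v F.1
  rw [Real.norm_eq_abs] at this
  split_ifs
  · exact this
  · rwa [abs_neg]

/-! ### Solutions leave a rectangle only through facets that are not repelling -/

/-- If a Lipschitz field does not point outwards on the facets outside `E`, then a solution that
starts in the rectangle stays there as long as it is not beyond a facet of `E`. -/
theorem mem_toSet_of_notMem_beyond {g : (Fin N → ℝ) → (Fin N → ℝ)} {L : ℝ≥0}
    (hg : LipschitzWith L g) {E : Finset (Facet N)}
    (hE : ∀ F ∉ E, ∀ x ∈ r.facet F, F.normal ⬝ᵥ g x ≤ 0) {y : ℝ → Fin N → ℝ} {a b : ℝ}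
    (hy : ∀ t ∈ Icc a b, HasDerivWithinAt y (g (y t)) (Icc a b) t) (ha : y a ∈ r.toSet)
    (hb : ∀ t ∈ Icc a b, ∀ F ∈ E, y t ∉ r.beyond F) : ∀ t ∈ Icc a b, y t ∈ r.toSet := by
  set d' : ℝ → ℝ := fun t => ∑ F : Facet N, 2 * max (r.excess F (y t)) 0 * (F.normal ⬝ᵥ g (y t))
  have hd : ∀ t ∈ Icc a b, HasDerivWithinAt (fun t => r.sqDist (y t)) (d' t) (Icc a b) t :=
    fun t ht => HasDerivWithinAt.fun_sum fun F _ =>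
      (hasDerivAt_max_zero_sq _).comp_hasDerivWithinAt t (r.hasDerivWithinAt_excess (hy t ht))
  -- Only facets with positive excess contribute, and these are outside `E`. At the nearest point
  -- the normal speed is at most `0`; moving back to `y t` adds at most `L` times the distance. Each
  -- facet thus contributes at most `2 * L` times the squared distance, and Grönwall from the
  -- initial value `0` keeps the distance at `0`.
  have hbound : ∀ t ∈ Icc a b, d' t ≤ (Fintype.card (Facet N) * (2 * L)) * r.sqDist (y t) + 0 := by
    intro t ht
    have hnn : 0 ≤ r.sqDist (y t) := Finset.sum_nonneg fun F _ => sq_nonneg _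
    rw [add_zero, mul_assoc, ← nsmul_eq_mul]
    refine Finset.sum_le_card_nsmul _ _ _ fun F _ => ?_
    rcases le_or_gt (r.excess F (y t)) 0 with h | h
    · rw [max_eq_right h, mul_zero, zero_mul]
      positivity
    · have hF : F ∉ E := fun hF => hb t ht F hF (r.mem_beyond.2 h)
      have h1 := hE F hF _ (r.clamp_mem_facet h)
      have h2 : F.normal ⬝ᵥ g (y t) - F.normal ⬝ᵥ g (r.clamp (y t)) ≤ L * √(r.sqDist (y t)) := by
        rw [← dotProduct_sub]
        refine (le_abs_self _).trans ((abs_normal_dotProduct_le F _).trans ?_)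
        rw [← dist_eq_norm]
        exact (hg.dist_le_mul _ _).trans
          (mul_le_mul_of_nonneg_left (r.dist_clamp_le _) L.coe_nonneg)
      have h3 : max (r.excess F (y t)) 0 ≤ √(r.sqDist (y t)) :=
        Real.le_sqrt_of_sq_le (r.max_excess_sq_le_sqDist F _)
      have h4 : 0 ≤ max (r.excess F (y t)) 0 := le_max_right _ _
      calc 2 * max (r.excess F (y t)) 0 * (F.normal ⬝ᵥ g (y t))
          ≤ 2 * max (r.excess F (y t)) 0 * (L * √(r.sqDist (y t))) :=
            mul_le_mul_of_nonneg_left (by linarith) (by positivity)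
        _ ≤ 2 * √(r.sqDist (y t)) * (L * √(r.sqDist (y t))) :=
            mul_le_mul_of_nonneg_right (by linarith) (by positivity)
        _ = 2 * L * (√(r.sqDist (y t)) * √(r.sqDist (y t))) := by ring
        _ = 2 * L * r.sqDist (y t) := by rw [Real.mul_self_sqrt hnn]
  intro t ht
  have h := le_gronwallBound_of_liminf_deriv_right_le (f := fun t => r.sqDist (y t)) (f' := d')
    (δ := 0) (ε := 0) (fun t ht => (hd t ht).continuousWithinAt) (fun t ht c hc => ?_)
    (r.mem_toSet_iff_sqDist.1 ha) (fun t ht => hbound t (Ico_subset_Icc_self ht)) t ht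
  · rw [gronwallBound_ε0_δ0] at h
    exact r.mem_toSet_iff_sqDist.2 h
  · have h1 : HasDerivWithinAt (fun t => r.sqDist (y t)) (d' t) (Ici t) t :=
      (hd t (Ico_subset_Icc_self ht)).mono_of_mem_nhdsWithin (Icc_mem_nhdsGE_of_mem ht)
    simpa only [slope_def_field, div_eq_inv_mul] using h1.liminf_right_slope_le hc

end Rect

/-! ### Time bounds for staying in a rectangle -/

/-- With `l` the side length, the excess over `F` stays in `[-l, 0]` and grows at rate at least `σ u
= s + (s - s') / l * u`. The formula is `∫ 1 / σ` over `[-l, 0]`; the antiderivative is linear if `s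
= s'` and logarithmic otherwise. -/
theorem SolvesIn.ofReal_sub_le_facetTimeBound {N : ℕ} {r : Rect N}
    {f : (Fin N → ℝ) → (Fin N → ℝ)} (hf : IsMultiAffine f) {x : ℝ → Fin N → ℝ} {t₀ t₁ : ℝ}
    (hx : SolvesIn f r x t₀ t₁) (F : Facet N) :
    ENNReal.ofReal (t₁ - t₀) ≤ r.facetTimeBound f F := by
  unfold Rect.facetTimeBound
  split_ifs with h heq
  all_goals try exact le_top
  all_goals
    refine ENNReal.ofReal_le_ofReal ?_
    have hs := r.minSpeed_pos f F F h
    have hs' := r.minSpeed_pos f F F.opp h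
    have hint := fun t ht => r.interpolation_le_speed hf F (hx.2 t ht).1
    have hder := fun t ht => r.hasDerivWithinAt_excess (F := F) (hx.2 t ht).2
    have hl : 0 < r.hi F.1 - r.lo F.1 := sub_pos.2 (r.lo_lt_hi _)
    have hmem : ∀ t ∈ Icc t₀ t₁, r.excess F (x t) ∈ Icc (-(r.hi F.1 - r.lo F.1)) 0 := fun t ht =>
      ⟨by rw [neg_sub]; exact r.neg_le_excess (hx.2 t ht).1,
        r.mem_toSet_iff_excess.1 (hx.2 t ht).1 F⟩
    set s := r.minSpeed f F F
    set s' := r.minSpeed f F F.opp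
    set l := r.hi F.1 - r.lo F.1
  · rw [← heq] at hs' ⊢
    have := sub_le_of_le_deriv (Ψ := fun u => u / s) (σ := fun _ => s) hx.1 hder hmem
      (fun t ht => by simpa [← heq] using hint t ht) (fun _ _ => hs)
      (fun u _ => by simpa using (hasDerivAt_id u).div_const s)
    refine this.trans (le_of_eq ?_)
    ring
  · have hne : s - s' ≠ 0 := sub_ne_zero.2 heq
    have hσ : ∀ u ∈ Icc (-l) 0, 0 < s + (s - s') / l * u := by
      intro u hu
      -- On `[-l, 0]`, `σ` interpolates between the positive numbers `s'` and `s`.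
      have : s + (s - s') / l * u = (s * (l + u) + s' * (-u)) / l := by
        field_simp
        ring
      rw [this]
      refine div_pos ?_ hl
      rcases hu.2.lt_or_eq with hu0 | rfl
      · exact add_pos_of_nonneg_of_pos (mul_nonneg hs.le (by linarith [hu.1]))
          (mul_pos hs' (by linarith))
      · simpa using mul_pos hs hl
    have := sub_le_of_le_deriv (Ψ := fun u => l / (s - s') * Real.log (s + (s - s') / l * u))
      (σ := fun u => s + (s - s') / l * u) hx.1 hder hmem hint hσ fun u hu => by
        have h1 : HasDerivAt (fun u => s + (s - s') / l * u) ((s - s') / l) u := by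
          simpa using ((hasDerivAt_id u).const_mul ((s - s') / l)).const_add s
        refine ((h1.log (hσ u hu).ne').const_mul (l / (s - s'))).congr_deriv ?_
        have := (hσ u hu).ne'
        field_simp
    refine this.trans (le_of_eq ?_)
    have e1 : s + (s - s') / l * 0 = s := by ring
    have e2 : s + (s - s') / l * -l = s' := by
      field_simp
      ring
    simp only [e1, e2]
    rw [Real.log_div hs.ne' hs'.ne']
    ring

/-- A solution cannot stay in the rectangle for a time longer than the time bound. -/
theorem SolvesIn.ofReal_sub_le_timeBound {N : ℕ} {r : Rect N}
    {f : (Fin N → ℝ) → (Fin N → ℝ)} (hf : IsMultiAffine f) {x : ℝ → Fin N → ℝ} {t₀ t₁ : ℝ}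
    (hx : SolvesIn f r x t₀ t₁) (E : Finset (Facet N)) :
    ENNReal.ofReal (t₁ - t₀) ≤ r.timeBound f E :=
  Finset.le_inf fun F _ => hx.ofReal_sub_le_facetTimeBound hf F

/-! ### Leaving a rectangle through the prescribed facets -/

/-- The rectangle enlarged by `1` on all sides. -/
def Rect.enlarge {N : ℕ} (r : Rect N) : Rect N where
  lo i := r.lo i - 1
  hi i := r.hi i + 1
  lo_lt_hi i := by linarith [r.lo_lt_hi i]

theorem Rect.mem_enlarge {N : ℕ} (r : Rect N) {x z : Fin N → ℝ} (hz : z ∈ r.toSet)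
    (h : dist x z ≤ 1) : x ∈ r.enlarge.toSet := by
  intro i
  have h1 := (dist_le_pi_dist x z i).trans h
  rw [Real.dist_eq, abs_le] at h1
  have h2 := hz i
  constructor <;> simp only [enlarge] <;> linarith [h1.1, h1.2, h2.1, h2.2]

theorem Rect.isCompact_toSet {N : ℕ} (r : Rect N) : IsCompact r.toSet := by
  have : r.toSet = Icc r.lo r.hi := by
    ext x
    simp [Rect.toSet, Pi.le_def, forall_and]
  rw [this]
  exact isCompact_Icc

/-- A multi-affine field agrees on a rectangle with a bounded Lipschitz field. -/
theorem IsMultiAffine.exists_lipschitzWith {N k : ℕ} {f : (Fin N → ℝ) → (Fin k → ℝ)}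
    (hf : IsMultiAffine f) (r : Rect N) :
    ∃ (g : (Fin N → ℝ) → (Fin k → ℝ)) (L M : ℝ≥0), LipschitzWith L g ∧ (∀ x, ‖g x‖ ≤ M) ∧
      ∀ x ∈ r.toSet, g x = f x := by
  obtain ⟨L, hL⟩ := (hf.contDiff.locallyLipschitz.locallyLipschitzOn
    (s := r.toSet)).exists_lipschitzOnWith_of_compact r.isCompact_toSet
  obtain ⟨M, hM⟩ := r.isCompact_toSet.exists_bound_of_continuousOn
    hf.contDiff.continuous.continuousOn
  refine ⟨f ∘ r.clamp, L, M.toNNReal, ?_,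
    fun x => (hM _ (r.clamp_mem x)).trans (Real.le_coe_toNNReal M),
    fun x hx => congrArg f (r.clamp_eq_self hx)⟩
  refine LipschitzWith.of_dist_le_mul fun x y => ?_
  have h := r.lipschitzWith_clamp.dist_le_mul x y
  rw [NNReal.coe_one, one_mul] at h
  exact (hL.dist_le_mul _ (r.clamp_mem x) _ (r.clamp_mem y)).trans
    (mul_le_mul_of_nonneg_left h L.coe_nonneg)

theorem HasDerivWithinAt.comp_sub_right {X : Type*} [NormedAddCommGroup X] [NormedSpace ℝ X]
    {y : ℝ → X} {v : X} {s : Set ℝ} {t : ℝ} (c : ℝ) {s' : Set ℝ} (h : HasDerivWithinAt y v s (t - c))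
    (hs : MapsTo (fun t => t - c) s' s) : HasDerivWithinAt (fun t => y (t - c)) v s' t := by
  simpa [Function.comp_def] using h.scomp t ((hasDerivWithinAt_id t s').sub_const c) hs

/-- From every point of the rectangle, the field leaves the rectangle after some time through a
facet in `E`, if it does not point outwards at the vertices of the other facets and the time bound
of `E` is finite. -/
theorem exists_solvesIn_leavesThrough {N : ℕ} {r : Rect N} {f : (Fin N → ℝ) → (Fin N → ℝ)}
    (hf : IsMultiAffine f) {E : Finset (Facet N)}
    (hE : ∀ (ξ : Fin N → Bool) (F : Facet N), ξ F.1 = F.2 → F ∉ E →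
      F.normal ⬝ᵥ f (r.vertex ξ) ≤ 0)
    (hT : r.timeBound f E ≠ ⊤) {z : Fin N → ℝ} (hz : z ∈ r.toSet) :
    ∃ (a : ℝ) (y : ℝ → Fin N → ℝ), y 0 = z ∧ SolvesIn f r y 0 a ∧
      ∃ F ∈ E, LeavesThrough f r F (y a) := by
  -- Agreement on the enlarged rectangle, not just on `r`, lets the solution of `g` solve the
  -- equation of `f` for a short time after it leaves `r`, as `LeavesThrough` requires.
  obtain ⟨g, L, M, hg, hM, hgf⟩ := hf.exists_lipschitzWith r.enlarge
  have hsub : ∀ {x}, x ∈ r.toSet → x ∈ r.enlarge.toSet := fun {x} hx =>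
    r.mem_enlarge hx (by simp)
  have hgE : ∀ F ∉ E, ∀ x ∈ r.facet F, F.normal ⬝ᵥ g x ≤ 0 := fun F hF x hx => by
    rw [hgf x (hsub hx.1)]
    exact r.speed_nonpos_of_mem_facet hf (fun ξ hξ => hE ξ F hξ hF) hx
  -- Any horizon longer than the time bound forces the solution out of `r` before `b`.
  set b : ℝ := (r.timeBound f E).toReal + 1
  have hb : 0 ≤ b := by positivity
  obtain ⟨y, hy0, hy⟩ := exists_solution hg hM z hb
  have hcont : ContinuousOn y (Icc 0 b) := fun t ht => (hy t ht).continuousWithinAt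
  have hsolves : ∀ a ∈ Icc 0 b, (∀ t ∈ Icc 0 a, y t ∈ r.toSet) → SolvesIn f r y 0 a := by
    intro a ha h
    refine ⟨ha.1, fun t ht => ⟨h t ht, ?_⟩⟩
    rw [← hgf _ (hsub (h t ht))]
    exact (hy t ⟨ht.1, ht.2.trans ha.2⟩).mono (Icc_subset_Icc_right ha.2)
  set S := {t ∈ Icc 0 b | y t ∉ r.toSet}
  have hS : S.Nonempty := by
    by_contra! hS
    have hall : ∀ t ∈ Icc 0 b, y t ∈ r.toSet := fun t ht => by
      by_contra h
      have : t ∈ S := ⟨ht, h⟩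
      rwa [hS] at this
    have h := (hsolves b ⟨hb, le_rfl⟩ hall).ofReal_sub_le_timeBound hf E
    rw [sub_zero, ENNReal.ofReal_le_iff_le_toReal hT] at h
    linarith
  have hbdd : BddBelow S := ⟨0, fun t ht => ht.1.1⟩
  set a := sInf S
  have ha0 : 0 ≤ a := le_csInf hS fun t ht => ht.1.1
  have hab : a ≤ b := (csInf_le hbdd hS.some_mem).trans hS.some_mem.1.2
  have hlt : ∀ t ∈ Ico 0 a, y t ∈ r.toSet := fun t ht => by
    by_contra h
    exact notMem_of_lt_csInf ht.2 hbdd ⟨⟨ht.1, ht.2.le.trans hab⟩, h⟩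
  have hle : ∀ t ∈ Icc 0 a, y t ∈ r.toSet := by
    -- The exit time may be `0`; then `Ico 0 a` is empty and the closure argument says nothing about
    -- time `0`.
    rcases ha0.eq_or_lt with h | h
    · intro t ht
      rw [← h, Icc_self] at ht
      rw [ht, hy0]
      exact hz
    · have hcl : IsClosed (Icc 0 b ∩ y ⁻¹' r.toSet) :=
        hcont.preimage_isClosed_of_isClosed isClosed_Icc r.isClosed_toSet
      have := closure_minimal (s := Ico 0 a) (t := Icc 0 b ∩ y ⁻¹' r.toSet)
        (fun t ht => ⟨⟨ht.1, ht.2.le.trans hab⟩, hlt t ht⟩) hcl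
      rw [closure_Ico h.ne] at this
      exact fun t ht => (this ht).2
  have haS : y a ∈ r.toSet := hle a ⟨ha0, le_rfl⟩
  have hgt : ∀ s ∈ S, a < s := fun s hs => by
    refine (csInf_le hbdd hs).lt_of_ne fun h => hs.2 ?_
    rw [← h]
    exact haS
  have hab' : a < b := (hgt _ hS.some_mem).trans_le hS.some_mem.1.2
  obtain ⟨δ, hδ, hδ'⟩ := Metric.continuousWithinAt_iff.1 (hcont a ⟨ha0, hab⟩) 1 one_pos
  set η := min (δ / 2) (b - a)
  have hη : 0 < η := lt_min (half_pos hδ) (sub_pos.2 hab')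
  have hηb : a + η ≤ b := by linarith [min_le_right (δ / 2) (b - a)]
  have hnear : ∀ t ∈ Icc a (a + η), y t ∈ r.enlarge.toSet := fun t ht => by
    refine r.mem_enlarge haS (hδ' ⟨ha0.trans ht.1, ht.2.trans hηb⟩ ?_).le
    rw [Real.dist_eq, abs_of_nonneg (sub_nonneg.2 ht.1)]
    linarith [ht.2, min_le_left (δ / 2) (b - a)]
  set u : ℝ → Fin N → ℝ := fun t => y (t - -a)
  have hu : ∀ t ∈ Icc 0 η, HasDerivWithinAt u (f (u t)) (Icc 0 η) t := fun t ht => by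
    have ht' : t - -a ∈ Icc a (a + η) := ⟨by linarith [ht.1], by linarith [ht.2]⟩
    have h := hy (t - -a) ⟨ha0.trans ht'.1, ht'.2.trans hηb⟩
    rw [hgf _ (hnear _ ht')] at h
    exact HasDerivWithinAt.comp_sub_right (-a) h fun t ht =>
      ⟨by linarith [ht.1], by linarith [ht.2]⟩
  have hu0 : u 0 = y a := by simp [u]
  have hout : ∀ δ ∈ Ioc 0 η, ∃ F ∈ E, ∃ t ∈ Ioo 0 δ, u t ∈ r.beyond F := by
    intro δ hδ
    -- If no facet of `E` is crossed before `δ`, the Grönwall argument keeps the solution in `r` up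
    -- to `a + δ / 2`, although `a` is the infimum of the times outside.
    by_contra! hno
    have hδη : a + δ / 2 ≤ b := by linarith [hδ.1, hδ.2]
    have hsubset : Icc a (a + δ / 2) ⊆ Icc 0 b := Icc_subset_Icc ha0 hδη
    have hstay := r.mem_toSet_of_notMem_beyond hg hgE (a := a) (b := a + δ / 2)
      (fun t ht => (hy t (hsubset ht)).mono hsubset) haS fun t ht F hF => by
        rcases ht.1.eq_or_lt with rfl | hat
        · rw [r.mem_beyond, not_lt]
          exact r.mem_toSet_iff_excess.1 haS F
        · have := hno F hF (t - a) ⟨sub_pos.2 hat, by linarith [ht.2, hδ.1]⟩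
          simpa [u] using this
    obtain ⟨s, hs, hs'⟩ := exists_lt_of_csInf_lt hS (show sInf S < a + δ / 2 by
      change a < a + δ / 2
      linarith [hδ.1])
    exact hs.2 (hstay s ⟨(hgt s hs).le, hs'.le⟩)
  -- The facet crossed so far depends on `δ`. If every facet of `E` failed below its own threshold,
  -- the least of these finitely many thresholds would contradict `hout`.
  obtain ⟨F, hF, hFout⟩ : ∃ F ∈ E, ∀ δ ∈ Ioc 0 η, ∃ t ∈ Ioo 0 δ, u t ∈ r.beyond F := by
    by_contra! hno
    choose! d hd hd' using hno
    have hne : E.Nonempty := let ⟨F, hF, _⟩ := hout η ⟨hη, le_rfl⟩; ⟨F, hF⟩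
    obtain ⟨G, hG, hmin⟩ := E.exists_min_image d hne
    obtain ⟨F, hF, t, ht, hbeyond⟩ := hout (d G) (hd G hG)
    exact hd' F hF t ⟨ht.1, ht.2.trans_le (hmin F hF)⟩ hbeyond
  refine ⟨a, y, hy0, hsolves a ⟨ha0, hab⟩ hle, F, hF, ?_, η, u, hη, hu0, hu, hFout⟩
  refine r.mem_facet.2 ⟨haS, (r.mem_toSet_iff_excess.1 haS F).antisymm ?_⟩
  -- A negative excess at exit would stay negative for a while, contradicting crossings of `F` at
  -- arbitrarily small times.
  by_contra! hneg
  have hc : ContinuousWithinAt (fun t => r.excess F (u t)) (Icc 0 η) 0 :=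
    (r.continuous_excess F).continuousAt.comp_continuousWithinAt
      (hu 0 ⟨le_rfl, hη.le⟩).continuousWithinAt
  obtain ⟨ρ, hρ, hρ'⟩ := Metric.continuousWithinAt_iff.1 hc (-r.excess F (y a)) (by linarith)
  obtain ⟨t, ht, hbeyond⟩ := hFout (min ρ η) ⟨lt_min hρ hη, min_le_right _ _⟩
  have htη := ht.2.trans_le (min_le_right ρ η)
  have htρ := ht.2.trans_le (min_le_left ρ η)
  have := hρ' (x := t) ⟨ht.1.le, htη.le⟩ (by rwa [Real.dist_eq, sub_zero, abs_of_pos ht.1])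
  rw [Real.dist_eq, hu0] at this
  have := (le_abs_self _).trans_lt this
  rw [r.mem_beyond] at hbeyond
  linarith

/-! ### The result of the fixed-point algorithm -/

namespace WeightedAut

variable {V I : Type*} (P : WeightedAut V I)

theorem candidate_mono {J J' : V → ℝ≥0∞} (h : J ≤ J') (v : V) (σ : I) :
    P.candidate J v σ ≤ P.candidate J' v σ := by
  unfold candidate
  split_ifs
  · exact add_le_add_left (iSup₂_mono fun v' _ => h v') _
  · exact le_rfl

/-- At states of finite cost that are not final, the cost is at least the worst cost that the
chosen input can lead to. -/
def CostBound (a : AlgState V I) : Prop :=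
  ∀ v, a.J v ≠ ⊤ → v ∈ P.accept ∨ ∃ σ, a.Ω v = some σ ∧ P.candidate a.J v σ ≤ a.J v

theorem costBound_algInit : P.CostBound P.algInit := by
  intro v hv
  by_contra! h
  exact hv (if_neg h.1)

/-- An update only lowers `J`, hence only lowers candidates. This is why the invariant is an
inequality: equality could fail once a successor improves, even at the updated state if it is its
own successor. -/
theorem CostBound.step {P : WeightedAut V I} {a a' : AlgState V I} (ha : P.CostBound a)
    (h : P.AlgStep a a') : P.CostBound a' := by
  classical
  cases h with
  | skip v hv h => exact ha
  | update v hv h σ hσ =>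
    have hlt : P.candidate a.J v σ < a.J v := (le_iInf hσ).trans_lt h
    intro v' hv'
    simp only at hv' ⊢
    have hle : Function.update a.J v (P.candidate a.J v σ) ≤ a.J := update_le_self_iff.2 hlt.le
    by_cases hvv : v' = v
    · subst hvv
      simp only [Function.update_self]
      exact Or.inr ⟨σ, rfl, P.candidate_mono hle _ _⟩
    · simp only [Function.update_of_ne hvv] at hv' ⊢
      refine (ha v' hv').imp_right fun ⟨σ', h1, h2⟩ => ⟨σ', h1, ?_⟩
      exact (P.candidate_mono hle _ _).trans h2

theorem IsAlgResult.costBound {P : WeightedAut V I} {J : V → ℝ≥0∞} {Ω : V → Option I}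
    (h : P.IsAlgResult J Ω) : P.CostBound ⟨J, Ω, ∅⟩ := by
  have : ∀ a, Relation.ReflTransGen P.AlgStep P.algInit a → P.CostBound a := fun a ha => by
    induction ha with
    | refl => exact P.costBound_algInit
    | tail _ hs ih => exact ih.step hs
  exact this _ h

end WeightedAut

section Strategy

variable {N m : ℕ} {P Q S : Type*} (sys : ControlSystem N m) {ρ : Regions sys.X P}
  (D : RectPartition ρ Q) (ε : ℝ) (K : Q → Finset (Facet N) → (Fin N → ℝ) → (Fin m → ℝ))
  (C : ControlAut S Q (Finset (Facet N))) (J : Q × S → ℝ≥0∞) (c : ℝ≥0∞)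

/-- Wherever the cost is less than `c` and the memory is not final, the control automaton outputs
an available set of exit facets, and the cost decreases by at least the time bound. -/
def DecreasesCost : Prop :=
  ∀ q s, J (q, s) < c → s ∉ C.accept → ∃ E s', C.out s q = some E ∧ C.next s q = some s' ∧
    Available sys D ε q E ∧ ∀ F ∈ E, ∀ q', D.CommonFacet q q' F →
      J (q', s') + (D.rect q).timeBound (sys.closedLoop (K q E)) E ≤ J (q, s)

/-- A finite candidate means that the chosen input has a successor in the product, which yields both
availability of `E` and a defined memory update. The maximum over successors dominates the cost of
each neighbour, whichever exit facet is taken. -/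
theorem decreasesCost_controlAut (A : FSA S P) (T : ℝ) {J : Q × S → ℝ≥0∞}
    {Ω : Q × S → Option (Finset (Facet N))}
    (hJΩ : (product (abstraction sys D ε K) A).IsAlgResult J Ω) :
    DecreasesCost sys D ε K (controlAut (abstraction sys D ε K) A J Ω T) J
      (ENNReal.ofReal T) := by
  intro q s hJ hs
  rcases hJΩ.costBound (q, s) (hJ.trans_le le_top).ne with h | ⟨E, hΩ, hE⟩
  · exact absurd h hs
  simp only at hΩ hE
  have hne : ((product (abstraction sys D ε K) A).succ (q, s) E).Nonempty := by
    by_contra h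
    rw [WeightedAut.candidate, if_neg h] at hE
    exact (hJ.trans_le le_top).ne (top_le_iff.1 hE)
  rw [WeightedAut.candidate, if_pos hne] at hE
  obtain ⟨p', ⟨hav, _⟩, hnext⟩ := hne
  refine ⟨E, p'.2, (if_pos hJ).trans hΩ, hnext, hav, fun F hF q' hq' => le_trans ?_ hE⟩
  refine add_le_add_left ?_ _
  exact le_iSup₂_of_le (f := fun v' _ => J v') (q', p'.2) ⟨⟨hav, F, hF, hq'⟩, hnext⟩ le_rfl

end Strategy

/-! ### Closed-loop trajectories -/

section ClosedLoop

variable {N m : ℕ} {P Q S : Type*} {sys : ControlSystem N m} {ρ : Regions sys.X P}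
  {D : RectPartition ρ Q} {ε : ℝ} {K : Q → Finset (Facet N) → (Fin N → ℝ) → (Fin m → ℝ)}
  {C : ControlAut S Q (Finset (Facet N))} {V₀ : Set (Q × S)} {J : Q × S → ℝ≥0∞} {c : ℝ≥0∞}
  {e : SwitchedPath N Q S}

theorem IsClosedLoop.t_le_succ (he : IsClosedLoop sys D K C V₀ e) {i : ℕ} (hi : i < e.n) :
    e.t i ≤ e.t (i + 1) := by
  obtain ⟨_, E, _, h, _⟩ := he.switch i hi
  exact h.1

theorem IsClosedLoop.t_mono (he : IsClosedLoop sys D K C V₀ e) {i j : ℕ} (hij : i ≤ j)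
    (hj : j ≤ e.n) : e.t i ≤ e.t j := by
  induction j, hij using Nat.le_induction with
  | base => exact le_rfl
  | succ j _ ih => exact (ih (by lia)).trans (he.t_le_succ hj)

theorem IsClosedLoop.t_nonneg (he : IsClosedLoop sys D K C V₀ e) {i : ℕ} (hi : i ≤ e.n) :
    0 ≤ e.t i :=
  he.t_zero ▸ he.t_mono i.zero_le hi

/-- The time in the rectangle is at most the weight. The drop is strict because the weight is
positive and the new cost is finite. -/
theorem IsClosedLoop.cost_succ (hK : IsFeedbackFamily sys D ε K)
    (hC : DecreasesCost sys D ε K C J c) (he : IsClosedLoop sys D K C V₀ e) {i : ℕ}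
    (hi : i < e.n) (hJ : J (e.q i, e.s i) < c) :
    J (e.q (i + 1), e.s (i + 1)) + ENNReal.ofReal (e.t (i + 1) - e.t i) ≤ J (e.q i, e.s i) ∧
      J (e.q (i + 1), e.s (i + 1)) < J (e.q i, e.s i) := by
  obtain ⟨hs, E, hout, hsol, ⟨F, hF, _, hq⟩, hnext⟩ := he.switch i hi
  obtain ⟨E', s', hout', hnext', hav, hcost⟩ := hC _ _ hJ hs
  obtain rfl : E = E' := Option.some_injective _ (hout.symm.trans hout')
  obtain rfl : e.s (i + 1) = s' := Option.some_injective _ (hnext.symm.trans hnext')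
  have h := hcost F hF _ hq
  refine ⟨(add_le_add_right (hsol.ofReal_sub_le_timeBound
    ((hK _ _ hav).multiAffine.closedLoop sys) E) _).trans h, lt_of_lt_of_le ?_ h⟩
  exact ENNReal.lt_add_right ((le_self_add.trans h).trans_lt (hJ.trans_le le_top)).ne
    (Rect.timeBound_pos _ _ _).ne'

theorem IsClosedLoop.time_add_cost_le (hK : IsFeedbackFamily sys D ε K)
    (hC : DecreasesCost sys D ε K C J c) (hV₀ : ∀ p ∈ V₀, J p < c)
    (he : IsClosedLoop sys D K C V₀ e) {i : ℕ} (hi : i ≤ e.n) :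
    ENNReal.ofReal (e.t i) + J (e.q i, e.s i) ≤ J (e.q 0, e.s 0) := by
  induction i with
  | zero => simp [he.t_zero]
  | succ i ih =>
    have ih := ih (by lia)
    have h := (he.cost_succ hK hC hi ((le_add_self.trans ih).trans_lt (hV₀ _ he.start))).1
    refine le_trans ?_ ((add_le_add_right h _).trans ih)
    rw [add_comm (J _), ← add_assoc, ← ENNReal.ofReal_add (he.t_nonneg (by lia))
      (sub_nonneg.2 (he.t_le_succ hi)), add_sub_cancel]

theorem IsClosedLoop.cost_lt (hK : IsFeedbackFamily sys D ε K)
    (hC : DecreasesCost sys D ε K C J c) (hV₀ : ∀ p ∈ V₀, J p < c)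
    (he : IsClosedLoop sys D K C V₀ e) {i : ℕ} (hi : i ≤ e.n) : J (e.q i, e.s i) < c :=
  (le_add_self.trans (he.time_add_cost_le hK hC hV₀ hi)).trans_lt (hV₀ _ he.start)

theorem IsClosedLoop.τ_eq (he : IsClosedLoop sys D K C V₀ e) (hc : e.IsComplete C) :
    e.τ = e.t e.n :=
  (he.last_le.eq_or_lt.resolve_right fun h => (he.last h).1 hc).symm

theorem not_switches_infinitely_often [Finite Q] [Finite S] (hK : IsFeedbackFamily sys D ε K)
    (hC : DecreasesCost sys D ε K C J c) (hV₀ : ∀ p ∈ V₀, J p < c) (q : ℕ → Q) (s : ℕ → S)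
    (t : ℕ → ℝ) (x : ℝ → Fin N → ℝ) :
    ¬ ∀ n, IsClosedLoop sys D K C V₀ ⟨n, q, s, t, x, t n⟩ := by
  intro h
  have hanti : StrictAnti fun n => J (q n, s n) := strictAnti_nat_of_succ_lt fun n =>
    ((h (n + 1)).cost_succ hK hC (i := n) n.lt_succ_self
      ((h (n + 1)).cost_lt hK hC hV₀ n.le_succ)).2
  -- Strictly decreasing costs make all visited pairs distinct.
  exact not_injective_infinite_finite (fun n => (q n, s n))
    fun a b hab => hanti.injective (congrArg J hab)

/-! ### Complete trajectories -/

theorem IsClosedLoop.satFinite {A : FSA S P} {Φ : ScLTL P} (hA : A.Recognizes Φ)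
    (hstart : ∀ p ∈ V₀, p.2 ∈ A.start) (hacc : C.accept = A.accept)
    (hnext : ∀ s q, C.next s q = A.next s (D.obs q)) (he : IsClosedLoop sys D K C V₀ e)
    (hc : e.IsComplete C) : Φ.SatFinite (e.word D.obs) := by
  refine hA.sound _ ⟨e.s, hstart _ he.start, ?_, fun i hi => ?_⟩
  · rw [SwitchedPath.word, List.length_ofFn, ← hacc]
    exact hc
  · rw [SwitchedPath.word, List.length_ofFn] at hi
    obtain ⟨_, _, _, _, _, h⟩ := he.switch i hi
    simpa [SwitchedPath.word, hnext] using h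

theorem IsClosedLoop.exists_mem_Ico (he : IsClosedLoop sys D K C V₀ e) {k : ℕ} (hk : k ≤ e.n)
    {t : ℝ} (ht : t ∈ Ico 0 (e.t k)) : ∃ i < k, t ∈ Ico (e.t i) (e.t (i + 1)) := by
  induction k with
  | zero =>
    rw [he.t_zero, Ico_self] at ht
    exact ht.elim
  | succ k ih =>
    rcases lt_or_ge t (e.t k) with h | h
    · obtain ⟨i, hi, hi'⟩ := ih (by lia) ⟨ht.1, h⟩
      exact ⟨i, by lia, hi'⟩
    · exact ⟨k, by lia, h, ht.2⟩

theorem IsClosedLoop.continuousOn (he : IsClosedLoop sys D K C V₀ e) {k : ℕ} (hk : k ≤ e.n) :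
    ContinuousOn e.x (Icc 0 (e.t k)) := by
  induction k with
  | zero =>
    rw [he.t_zero, Icc_self]
    exact continuousOn_singleton _ _
  | succ k ih =>
    rw [← Icc_union_Icc_eq_Icc (he.t_nonneg (i := k) (by lia)) (he.t_le_succ hk)]
    refine (ih (by lia)).union_of_isClosed (fun t ht => ?_) isClosed_Icc isClosed_Icc
    obtain ⟨_, E, _, hsol, _⟩ := he.switch k hk
    exact (hsol.2 t ht).2.continuousWithinAt

theorem RectPartition.mem_X {X : Rect N} {ρ : Regions X P} (D : RectPartition ρ Q) {q : Q}
    {x : Fin N → ℝ} (hx : x ∈ (D.rect q).toSet) : x ∈ X.toSet :=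
  D.cover ▸ mem_iUnion_of_mem q hx

/-- The half-open visit intervals cover `[0, τ)`, instantaneous visits contributing nothing. The
visit beginning at a switching time supplies the derivative from the right. -/
theorem IsClosedLoop.isTrajectory (hK : IsFeedbackFamily sys D ε K)
    (hC : DecreasesCost sys D ε K C J c) (hV₀ : ∀ p ∈ V₀, J p < c)
    (he : IsClosedLoop sys D K C V₀ e) (hc : e.IsComplete C) : sys.IsTrajectory e.x e.τ := by
  rw [he.τ_eq hc]
  refine ⟨he.continuousOn le_rfl, fun t ht => ?_, ?_⟩
  · rcases ht.2.eq_or_lt with rfl | h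
    · exact D.mem_X he.last_mem
    · obtain ⟨i, hi, hti⟩ := he.exists_mem_Ico le_rfl ⟨ht.1, h⟩
      obtain ⟨_, E, _, hsol, _⟩ := he.switch i hi
      exact D.mem_X (hsol.2 t (Ico_subset_Icc_self hti)).1
  · have : ∀ t, ∃ u, t ∈ Ico 0 (e.t e.n) → u ∈ sys.U ∧
        HasDerivWithinAt e.x (sys.h (e.x t) + sys.B *ᵥ u) (Ici t) t := by
      intro t
      by_cases ht : t ∈ Ico 0 (e.t e.n)
      · obtain ⟨i, hi, hti⟩ := he.exists_mem_Ico le_rfl ht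
        obtain ⟨hs, E, hout, hsol, _⟩ := he.switch i hi
        obtain ⟨E', _, hout', _, hav, _⟩ := hC _ _ (he.cost_lt hK hC hV₀ hi.le) hs
        obtain rfl : E = E' := Option.some_injective _ (hout.symm.trans hout')
        obtain ⟨hx, hd⟩ := hsol.2 t (Ico_subset_Icc_self hti)
        exact ⟨K (e.q i) E (e.x t), fun _ => ⟨(hK _ _ hav).mapsTo hx,
          hd.mono_of_mem_nhdsWithin (Icc_mem_nhdsGE_of_mem hti)⟩⟩
      · exact ⟨0, fun h => absurd h ht⟩
    exact Classical.skolem.1 this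

theorem IsClosedLoop.τ_lt {T : ℝ} (hK : IsFeedbackFamily sys D ε K)
    (hC : DecreasesCost sys D ε K C J (ENNReal.ofReal T))
    (hV₀ : ∀ p ∈ V₀, J p < ENNReal.ofReal T) (he : IsClosedLoop sys D K C V₀ e)
    (hc : e.IsComplete C) : e.τ < T := by
  rw [he.τ_eq hc]
  have := (le_self_add.trans (he.time_add_cost_le hK hC hV₀ le_rfl)).trans_lt (hV₀ _ he.start)
  exact (ENNReal.ofReal_lt_ofReal_iff_of_nonneg (he.t_nonneg le_rfl)).1 this

/-! ### Continuation of closed-loop trajectories -/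

theorem SwitchedPath.Extends.refl (e : SwitchedPath N Q S) : e.Extends e :=
  ⟨le_rfl, le_rfl, fun _ _ => rfl, fun _ _ => rfl, fun _ _ => rfl, fun _ _ => rfl,
    fun _ h h' => absurd h h'.not_gt⟩

theorem SwitchedPath.Extends.trans {e e' e'' : SwitchedPath N Q S} (h' : e''.Extends e')
    (h : e'.Extends e) : e''.Extends e where
  n_le := h.n_le.trans h'.n_le
  τ_le := h.τ_le.trans h'.τ_le
  q_eq i hi := (h'.q_eq i (hi.trans h.n_le)).trans (h.q_eq i hi)
  s_eq i hi := (h'.s_eq i (hi.trans h.n_le)).trans (h.s_eq i hi)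
  t_eq i hi := (h'.t_eq i (hi.trans h.n_le)).trans (h.t_eq i hi)
  x_eq t ht := (h'.x_eq t ⟨ht.1, ht.2.trans h.τ_le⟩).trans (h.x_eq t ht)
  le_t i hi hi' := by
    rcases le_or_gt i e'.n with hn | hn
    · rw [h'.t_eq i hn]
      exact h.le_t i hi hn
    · exact h.τ_le.trans (h'.le_t i hn hi')

theorem SolvesIn.congr {f : (Fin N → ℝ) → (Fin N → ℝ)} {r : Rect N} {x x' : ℝ → Fin N → ℝ}
    {t₀ t₁ : ℝ} (h : SolvesIn f r x t₀ t₁) (hx : ∀ t ∈ Icc t₀ t₁, x' t = x t) :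
    SolvesIn f r x' t₀ t₁ := by
  refine ⟨h.1, fun t ht => ?_⟩
  rw [hx t ht]
  exact ⟨(h.2 t ht).1, (h.2 t ht).2.congr hx (hx t ht)⟩

theorem SolvesIn.union {f : (Fin N → ℝ) → (Fin N → ℝ)} {r : Rect N} {x : ℝ → Fin N → ℝ}
    {t₀ t₁ t₂ : ℝ} (h : SolvesIn f r x t₀ t₁) (h' : SolvesIn f r x t₁ t₂) :
    SolvesIn f r x t₀ t₂ := by
  refine ⟨h.1.trans h'.1, fun t ht => ?_⟩
  -- Outside a closed interval the derivative within it is vacuous, so the two one-sided statements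
  -- can be united at every time, including the junction.
  have hderiv : ∀ {a b s : ℝ}, (∀ t ∈ Icc a b, HasDerivWithinAt x (f (x t)) (Icc a b) t) →
      HasDerivWithinAt x (f (x s)) (Icc a b) s := fun {a b s} hab => by
    by_cases hs : s ∈ Icc a b
    · exact hab s hs
    · exact HasFDerivWithinAt.of_notMem_closure (by rwa [isClosed_Icc.closure_eq])
  constructor
  · rcases le_total t t₁ with h1 | h1
    · exact (h.2 t ⟨ht.1, h1⟩).1
    · exact (h'.2 t ⟨h1, ht.2⟩).1
  · rw [← Icc_union_Icc_eq_Icc h.1 h'.1]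
    exact (hderiv fun t ht => (h.2 t ht).2).union (hderiv fun t ht => (h'.2 t ht).2)

theorem SolvesIn.comp_sub {f : (Fin N → ℝ) → (Fin N → ℝ)} {r : Rect N} {y : ℝ → Fin N → ℝ}
    {a : ℝ} (h : SolvesIn f r y 0 a) (c : ℝ) :
    SolvesIn f r (fun t => y (t - c)) c (c + a) := by
  refine ⟨by linarith [h.1], fun t ht => ?_⟩
  have ht' : t - c ∈ Icc 0 a := ⟨sub_nonneg.2 ht.1, by linarith [ht.2]⟩
  exact ⟨(h.2 _ ht').1, HasDerivWithinAt.comp_sub_right c (h.2 _ ht').2 fun s hs =>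
    ⟨sub_nonneg.2 hs.1, by linarith [hs.2]⟩⟩

theorem SolvesIn.refl (f : (Fin N → ℝ) → (Fin N → ℝ)) {r : Rect N} {x : ℝ → Fin N → ℝ} {t : ℝ}
    (h : x t ∈ r.toSet) : SolvesIn f r x t t := by
  refine ⟨le_rfl, fun s hs => ?_⟩
  rw [Icc_self] at hs ⊢
  rw [mem_singleton_iff.1 hs]
  exact ⟨h, HasFDerivWithinAt.of_subsingleton subsingleton_singleton⟩

/-- A closed-loop trajectory that is not complete can be continued until its next switch. -/
theorem IsClosedLoop.exists_extends_succ (hε : 0 ≤ ε) (hK : IsFeedbackFamily sys D ε K)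
    (hC : DecreasesCost sys D ε K C J c) (hV₀ : ∀ p ∈ V₀, J p < c)
    (he : IsClosedLoop sys D K C V₀ e) (hs : e.s e.n ∉ C.accept) :
    ∃ e' : SwitchedPath N Q S, IsClosedLoop sys D K C V₀ e' ∧ e'.Extends e ∧ e'.n = e.n + 1 := by
  classical
  have hJ := he.cost_lt hK hC hV₀ le_rfl
  obtain ⟨E, s', hout, hnext, hav, hcost⟩ := hC _ _ hJ hs
  have hsol := hK _ _ hav
  -- The path may stop in the middle of a visit. The control output is determined by memory and
  -- rectangle, so the unfinished visit already uses the same `E` and is continued from `e.τ`, not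
  -- restarted at its last switch.
  have hlast : SolvesIn (sys.closedLoop (K (e.q e.n) E)) (D.rect (e.q e.n)) e.x (e.t e.n) e.τ := by
    rcases he.last_le.eq_or_lt with h | h
    · rw [← h]
      exact SolvesIn.refl _ he.last_mem
    · obtain ⟨_, E', hout', hx⟩ := he.last h
      obtain rfl : E' = E := Option.some_injective _ (hout'.symm.trans hout)
      exact hx
  -- A facet of `E` leads to some successor, so the weight is a summand of a quantity bounded by the
  -- finite current cost.
  have hT : (D.rect (e.q e.n)).timeBound (sys.closedLoop (K (e.q e.n) E)) E ≠ ⊤ := by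
    obtain ⟨F, hF⟩ := hav.1
    obtain ⟨q', hq'⟩ := hav.2.1 F hF
    exact ((le_add_self.trans (hcost F hF q' hq')).trans_lt (hJ.trans_le le_top)).ne
  obtain ⟨a, y, hy0, hy, F, hF, hleave⟩ := exists_solvesIn_leavesThrough
    (hsol.multiAffine.closedLoop sys)
    (fun ξ F hξ hF => (hsol.inward ξ F hξ hF).trans (neg_nonpos.2 hε)) hT
    (hlast.2 e.τ (right_mem_Icc.2 hlast.1)).1
  obtain ⟨q', hq'⟩ := hav.2.1 F hF
  have ha : 0 ≤ a := hy.1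
  set x : ℝ → Fin N → ℝ := fun t => if t ≤ e.τ then e.x t else y (t - e.τ) with hx
  have hx₁ : ∀ t ≤ e.τ, x t = e.x t := fun t ht => if_pos ht
  have hx₂ : ∀ t, e.τ ≤ t → x t = y (t - e.τ) := by
    intro t ht
    rcases ht.eq_or_lt with rfl | h
    · rw [hx₁ _ le_rfl, sub_self, hy0]
    · exact if_neg h.not_ge
  have hxa : x (e.τ + a) = y a := by rw [hx₂ _ (by linarith), add_sub_cancel_left]
  have htτ : ∀ i ≤ e.n, e.t i ≤ e.τ := fun i hi => (he.t_mono hi le_rfl).trans he.last_le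
  have hq : ∀ i ≤ e.n, Function.update e.q (e.n + 1) q' i = e.q i := fun i hi =>
    Function.update_of_ne (by lia) _ _
  have hs' : ∀ i ≤ e.n, Function.update e.s (e.n + 1) s' i = e.s i := fun i hi =>
    Function.update_of_ne (by lia) _ _
  have ht : ∀ i ≤ e.n, Function.update e.t (e.n + 1) (e.τ + a) i = e.t i := fun i hi =>
    Function.update_of_ne (by lia) _ _
  refine ⟨⟨e.n + 1, Function.update e.q (e.n + 1) q', Function.update e.s (e.n + 1) s',
    Function.update e.t (e.n + 1) (e.τ + a), x, e.τ + a⟩, ⟨?_, ?_, ?_, ?_, ?_, ?_⟩,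
    ⟨e.n.le_succ, by simpa using ha, hq, hs', ht, fun t ht => hx₁ t ht.2, ?_⟩, rfl⟩
  · exact (ht 0 (Nat.zero_le _)).trans he.t_zero
  · simp only [hq 0 (Nat.zero_le _), hs' 0 (Nat.zero_le _)]
    exact he.start
  · intro i hi
    rcases (Nat.lt_succ_iff.1 hi).eq_or_lt with rfl | hin
    · simp only [hq _ le_rfl, hs' _ le_rfl, ht _ le_rfl, Function.update_self, hxa]
      refine ⟨hs, E, hout, ?_, ⟨F, hF, hleave, hq'⟩, hnext⟩
      exact (hlast.congr fun t ht => hx₁ t ht.2).union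
        ((hy.comp_sub e.τ).congr fun t ht => hx₂ t ht.1)
    · obtain ⟨h1, E, h2, h3, h4, h5⟩ := he.switch i hin
      simp only [hq i hin.le, hs' i hin.le, ht i hin.le, hq (i + 1) hin, hs' (i + 1) hin,
        ht (i + 1) hin, hx₁ _ (htτ (i + 1) hin)]
      exact ⟨h1, E, h2, h3.congr fun t ht => hx₁ t (ht.2.trans (htτ (i + 1) hin)), h4, h5⟩
  · simp only [Function.update_self, hxa]
    -- The exit point lies on the common facet, hence also in the new rectangle.
    have h : y a ∈ (D.rect (e.q e.n)).facet F := hleave.1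
    rw [show (D.rect (e.q e.n)).facet F = (D.rect q').facet F.opp from hq'] at h
    exact h.1
  · simp
  · intro h
    simp at h
  · intro i hi hi'
    obtain rfl : i = e.n + 1 := le_antisymm hi' hi
    simpa using ha

/-- Each continuation to the next switch lowers the cost of the current pair, and the strict order
by cost is well-founded on the finite set `Q × S`. -/
theorem IsClosedLoop.exists_extends_isComplete [Finite Q] [Finite S] (hε : 0 ≤ ε)
    (hK : IsFeedbackFamily sys D ε K) (hC : DecreasesCost sys D ε K C J c)
    (hV₀ : ∀ p ∈ V₀, J p < c) (he : IsClosedLoop sys D K C V₀ e) :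
    ∃ e' : SwitchedPath N Q S, IsClosedLoop sys D K C V₀ e' ∧ e'.Extends e ∧ e'.IsComplete C := by
  let R : Q × S → Q × S → Prop := fun p p' => J p < J p'
  have : IsTrans (Q × S) R := ⟨fun _ _ _ => lt_trans⟩
  have : Std.Irrefl R := ⟨fun _ => lt_irrefl _⟩
  have hwf : WellFounded R := Finite.wellFounded_of_trans_of_irrefl R
  generalize hp : (e.q e.n, e.s e.n) = p
  induction p using hwf.induction generalizing e with
  | _ p ih =>
    by_cases hs : e.s e.n ∈ C.accept
    · exact ⟨e, he, .refl e, hs⟩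
    obtain ⟨e', he', hext, hn⟩ := he.exists_extends_succ hε hK hC hV₀ hs
    have hlt : R (e'.q e'.n, e'.s e'.n) p := by
      have h := (he'.cost_succ hK hC (i := e.n) (by lia) (he'.cost_lt hK hC hV₀ (by lia))).2
      rwa [← hn, hext.q_eq _ le_rfl, hext.s_eq _ le_rfl, hp] at h
    obtain ⟨e'', he'', hext', hc⟩ := ih _ hlt he' rfl
    exact ⟨e'', he'', hext'.trans hext, hc⟩

/-- The trivial path of duration `0` reduces existence of complete trajectories to the continuation
result. -/
theorem exists_isClosedLoop_of_mem {p : Q × S} (hp : p ∈ V₀) {x₀ : Fin N → ℝ}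
    (hx₀ : x₀ ∈ (D.rect p.1).toSet) :
    ∃ e : SwitchedPath N Q S, IsClosedLoop sys D K C V₀ e ∧ (e.q 0, e.s 0) = p ∧ e.x 0 = x₀ ∧
      e.τ = 0 :=
  ⟨⟨0, fun _ => p.1, fun _ => p.2, fun _ => 0, fun _ => x₀, 0⟩,
    { t_zero := rfl
      start := hp
      switch := fun i hi => absurd hi (Nat.not_lt_zero i)
      last_mem := hx₀
      last_le := le_rfl
      last := fun h => absurd h (lt_irrefl _) }, rfl, rfl, rfl⟩

end ClosedLoop

end MultiAffineControl

theorem theorem2 {N m : ℕ} {P Q S : Type*} [Finite P] [Finite Q] [Finite S]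
    (sys : ControlSystem N m) (ρ : Regions sys.X P) (D : RectPartition ρ Q)
    (Φ : ScLTL P) (A : FSA S P) (hA : A.Recognizes Φ)
    (ε : ℝ) (hε : 0 ≤ ε)
    (K : Q → Finset (Facet N) → (Fin N → ℝ) → (Fin m → ℝ))
    (hK : IsFeedbackFamily sys D ε K)
    (T : ℝ) (J : Q × S → ℝ≥0∞) (Ω : Q × S → Option (Finset (Facet N)))
    (hJΩ : (product (abstraction sys D ε K) A).IsAlgResult J Ω)
    (C : ControlAut S Q (Finset (Facet N)))
    (hC : C = controlAut (abstraction sys D ε K) A J Ω T)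
    (V₀ : Set (Q × S))
    (hV₀ : V₀ = (product (abstraction sys D ε K) A).winningStart J T)
    (x₀ : Fin N → ℝ) (hx₀ : x₀ ∈ initialSet D V₀) :
    -- from every admissible initial pair there is a closed-loop trajectory that is complete
    (∀ p ∈ V₀, x₀ ∈ (D.rect p.1).toSet → ∃ e : SwitchedPath N Q S,
      IsClosedLoop sys D K C V₀ e ∧ (e.q 0, e.s 0) = p ∧ e.x 0 = x₀ ∧ e.IsComplete C) ∧
    -- every closed-loop trajectory from `x₀` can be continued to a complete one
    (∀ e : SwitchedPath N Q S, IsClosedLoop sys D K C V₀ e → e.x 0 = x₀ →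
      ∃ e' : SwitchedPath N Q S, IsClosedLoop sys D K C V₀ e' ∧ e'.Extends e ∧
        e'.IsComplete C) ∧
    -- no closed-loop trajectory from `x₀` switches infinitely often
    (¬ ∃ (q : ℕ → Q) (s : ℕ → S) (t : ℕ → ℝ) (x : ℝ → (Fin N → ℝ)), x 0 = x₀ ∧
      ∀ n, IsClosedLoop sys D K C V₀ ⟨n, q, s, t, x, t n⟩) ∧
    -- every complete one is a trajectory of the system, takes less than `T` and satisfies `Φ`
    (∀ e : SwitchedPath N Q S, IsClosedLoop sys D K C V₀ e → e.x 0 = x₀ → e.IsComplete C →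
      sys.IsTrajectory e.x e.τ ∧ e.τ < T ∧ Φ.SatFinite (e.word D.obs)) := by
  subst hC hV₀
  have hdec := decreasesCost_controlAut sys D ε K A T hJΩ
  have hlt : ∀ p ∈ (product (abstraction sys D ε K) A).winningStart J T,
      J p < ENNReal.ofReal T := fun _ hp => hp.2
  refine ⟨fun p hp hx => ?_, fun e he _ => he.exists_extends_isComplete hε hK hdec hlt,
    fun ⟨q, s, t, x, _, h⟩ => not_switches_infinitely_often hK hdec hlt q s t x h,
    fun e he _ hc => ⟨he.isTrajectory hK hdec hlt hc, he.τ_lt hK hdec hlt hc,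
      he.satFinite hA (fun _ hp => hp.1) rfl (fun _ _ => rfl) hc⟩⟩
  obtain ⟨e, he, hp', hx', hτ⟩ := exists_isClosedLoop_of_mem (sys := sys) (K := K)
    (C := controlAut (abstraction sys D ε K) A J Ω T) hp hx
  obtain ⟨e', he', hext, hc⟩ := he.exists_extends_isComplete hε hK hdec hlt
  refine ⟨e', he', ?_, ?_, hc⟩
  · rw [hext.q_eq 0 (Nat.zero_le _), hext.s_eq 0 (Nat.zero_le _), hp']
  · rw [hext.x_eq 0 ⟨le_rfl, hτ.ge⟩, hx']
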